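/- **Definitions.** A *signature* is a finite set of relation symbols $R$, each with a positive arity $k_R$; a *fact* $R(c_1,\dots,c_{k_R})$ is a relation symbol applied to constants from a fixed infinite set, and an *instance* is a finite set of facts. A *functional dependency* (FD) $R:X\to Y$, with $X,Y\subseteq\{1,\dots,k_R\}$, is satisfied by an instance if any two of its $R$-facts that agree on the attributes in $X$ also agree on those in $Y$. A *schema* $\mathbf S=(\mathcal R,\Delta)$ is a signature $\mathcal R$ with a set $\Delta$ of FDs over $\mathcal R$; $\Delta_{|R}$ is the set of the FDs of $\Delta$ that are over $R$. Two sets of FDs are *equivalent* if they are satisfied by the same instances. For an instance $I$ over $\mathbf S$, the *conflict graph* has the facts of $I$ as its nodes and an edge between any two facts that together violate an FD in $\Delta$. A *priority relation* over $I$ is an acyclic binary relation $\succ$ on the facts of $I$ such that $f\succ g$ only if $f$ and $g$ are neighbors in the conflict graph. A subset $J\subseteq I$ is *consistent* if it is an independent set of the conflict graph. For distinct consistent $J,J'\subseteq I$, $J$ is a *global improvement* of $J'$ if for every $f'\in J'\setminus J$ there is $f\in J\setminus J'$ with $f\succ f'$. A *globally-optimal repair* (g-repair) is a consistent $J\subseteq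 I$ that has no global improvement. For a fixed schema $\mathbf S$, the problem *g-categoricity*$\langle\mathbf S\rangle$ is: given an instance $I$ over $\mathbf S$ and a priority relation $\succ$ over $I$, decide whether there is exactly one g-repair. A problem is *coNP-hard* if every language in coNP has a polynomial-time many-one reduction to it. Let $\mathbf S^0$ be the schema with a single relation symbol, of arity $2$, with attributes $A,B$, and with the FDs $A\to B$ and $B\to A$. **Theorem.** The following are equivalent. 1. g-categoricity$\langle\mathbf S^0\rangle$ is coNP-hard. 2. g-categoricity$\langle\mathbf S\rangle$ is coNP-hard for every schema $\mathbf S=(\mathcal R,\Delta)$ for which it is not the case that, for every $R\in\mathcal R$, $\Delta_{|R}$ is equivalent to a single FD over $R$ (which may be trivial). -/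

import Mathlib

namespace CleanDB

/-! ### Signatures, facts and instances -/

/-- The infinite set of constants: all finite bit strings. -/
abbrev Const : Type := List Bool

/-- A relational signature `{R_0, …, R_{num - 1}}`, each symbol having a positive arity. -/
structure Signature where
  num : ℕ
  arity : Fin num → ℕ
  arity_pos : ∀ R, 0 < arity R

/-- A fact `R(t)` over a signature. -/
abbrev Fact (σ : Signature) : Type := Σ R : Fin σ.num, (Fin (σ.arity R) → Const)

/-- A (finite) instance, identified with the set of its facts. -/
abbrev Instance (σ : Signature) : Type := Finset (Fact σ)

/-! ### Functional dependencies and schemas -/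

/-- A functional dependency `rel : lhs → rhs`. -/
structure FD (σ : Signature) where
  rel : Fin σ.num
  lhs : Finset (Fin (σ.arity rel))
  rhs : Finset (Fin (σ.arity rel))

/-- The instance `I` satisfies the functional dependency `d`. -/
def FD.SatisfiedBy {σ : Signature} (d : FD σ) (I : Instance σ) : Prop :=
  ∀ t u : Fin (σ.arity d.rel) → Const, (⟨d.rel, t⟩ : Fact σ) ∈ I → (⟨d.rel, u⟩ : Fact σ) ∈ I →
    (∀ i ∈ d.lhs, t i = u i) → ∀ i ∈ d.rhs, t i = u i

/-- The instance `I` satisfies every functional dependency of `Δ`. -/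
def Satisfies {σ : Signature} (I : Instance σ) (Δ : Set (FD σ)) : Prop :=
  ∀ d ∈ Δ, d.SatisfiedBy I

/-- Equivalence of sets of functional dependencies. -/
def Equivalent {σ : Signature} (Δ Δ' : Set (FD σ)) : Prop :=
  ∀ I : Instance σ, Satisfies I Δ ↔ Satisfies I Δ'

/-- A schema: a signature together with a set of functional dependencies over it. -/
structure Schema where
  sig : Signature
  deps : Set (FD sig)

/-- The dependencies of the schema that are over the relation symbol `R`. -/
def Schema.depsOn (S : Schema) (R : Fin S.sig.num) : Set (FD S.sig) :=
  {d ∈ S.deps | d.rel = R}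

/-- For every relation symbol `R`, the dependencies over `R` are equivalent to a single
functional dependency over `R` (possibly a trivial one). -/
def Schema.SingleFDPerRelation (S : Schema) : Prop :=
  ∀ R : Fin S.sig.num, ∃ d : FD S.sig, d.rel = R ∧ Equivalent (S.depsOn R) {d}

/-- The signature with a single, binary, relation symbol. -/
abbrev sigZero : Signature where
  num := 1
  arity := fun _ => 2
  arity_pos := fun _ => Nat.two_pos

/-- The schema with a single binary relation symbol and the two functional dependencies
`A → B` and `B → A`. -/
abbrev schemaZero : Schema where
  sig := sigZero
  deps := {(⟨(0 : Fin 1), {(0 : Fin 2)}, {(1 : Fin 2)}⟩ : FD sigZero),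
    (⟨(0 : Fin 1), {(1 : Fin 2)}, {(0 : Fin 2)}⟩ : FD sigZero)}

/-! ### Conflict hypergraphs, priorities and globally-optimal repairs -/

section Repairs

variable {σ : Signature}

/-- The conflict graph of the instance `I` over the schema `S`: its edges are the sets of two
facts of `I` that violate some functional dependency of `S`. (A set `{f, f}` violates none.) -/
def conflictGraph (S : Schema) (I : Instance S.sig) : Set (Finset (Fact S.sig)) :=
  {e | ∃ f ∈ I, ∃ g ∈ I, e = {f, g} ∧ ∃ d ∈ S.deps, ¬ d.SatisfiedBy {f, g}}

/-- Two facts are neighbors in a hypergraph if they co-occur in some hyperedge. -/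
def Neighbors (H : Set (Finset (Fact σ))) (f g : Fact σ) : Prop :=
  ∃ e ∈ H, f ∈ e ∧ g ∈ e

/-- `(I, H, prec)` is an inconsistent prioritizing instance, where `prec f g` reads `f ≻ g`. -/
structure IsPrioritizing (I : Instance σ) (H : Set (Finset (Fact σ)))
    (prec : Fact σ → Fact σ → Prop) : Prop where
  edge_subset : ∀ e ∈ H, e ⊆ I
  mem : ∀ f g, prec f g → f ∈ I ∧ g ∈ I
  acyclic : ∀ f, ¬ Relation.TransGen prec f f
  neighbors : ∀ f g, prec f g → Neighbors H f g

/-- `J` is a consistent subinstance of `I`: it contains no hyperedge. -/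
def IsConsistentSub (I : Instance σ) (H : Set (Finset (Fact σ))) (J : Instance σ) : Prop :=
  J ⊆ I ∧ ∀ e ∈ H, ¬ e ⊆ J

/-- `J` is a global improvement of `J'`. -/
def IsGlobalImprovement (I : Instance σ) (H : Set (Finset (Fact σ)))
    (prec : Fact σ → Fact σ → Prop) (J J' : Instance σ) : Prop :=
  IsConsistentSub I H J ∧ IsConsistentSub I H J' ∧ J ≠ J' ∧
    ∀ f' ∈ J' \ J, ∃ f ∈ J \ J', prec f f'

/-- `J` is a globally-optimal repair. -/
def IsGRepair (I : Instance σ) (H : Set (Finset (Fact σ)))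
    (prec : Fact σ → Fact σ → Prop) (J : Instance σ) : Prop :=
  IsConsistentSub I H J ∧ ¬ ∃ K, IsGlobalImprovement I H prec K J

end Repairs

/-! ### The problem g-categoricity for a fixed schema -/

/-- An input of g-categoricity over the schema `S`: an instance, given by a list of its facts, and
a priority relation over it, given by a list of pairs. The pair `(f, g)` is listed if `f ≻ g`. The
conflict hypergraph is the conflict graph of the instance over `S`. -/
structure Input (S : Schema) where
  facts : List (Fact S.sig)
  pairs : List (Fact S.sig × Fact S.sig)
  valid : IsPrioritizing facts.toFinset (conflictGraph S facts.toFinset)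
    (fun f g => (f, g) ∈ pairs)

/-- `J` is a globally-optimal repair of the input. -/
def Input.IsGRepair {S : Schema} (D : Input S) (J : Instance S.sig) : Prop :=
  CleanDB.IsGRepair D.facts.toFinset (conflictGraph S D.facts.toFinset)
    (fun f g => (f, g) ∈ D.pairs) J

/-- g-categoricity over `S`, as the set of its yes-instances: there is exactly one
globally-optimal repair. -/
def GCategoricity (S : Schema) : Set (Input S) :=
  {D | ∃! J : Instance S.sig, D.IsGRepair J}

/-- The alphabet in which inputs of g-categoricity are written. -/
inductive Token where
  | bit (b : Bool)
  | rel
  | endConst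
  | endFact
  | endInstance
  deriving DecidableEq, Fintype

/-- A constant is written as its bits, followed by an end marker. -/
def encodeConst (c : Const) : List Token :=
  c.map Token.bit ++ [Token.endConst]

/-- A fact is written as the index of its relation symbol in unary, followed by its constants and
an end marker. -/
def encodeFact {σ : Signature} (f : Fact σ) : List Token :=
  List.replicate (f.1 : ℕ) Token.rel ++ (List.ofFn f.2).flatMap encodeConst ++ [Token.endFact]

/-- An input is written as the list of its facts, an end marker, and the list of the facts
`f₁, g₁, f₂, g₂, …` of its priority pairs. -/
def encodeInput {S : Schema} (D : Input S) : List Token :=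
  D.facts.flatMap encodeFact ++ [Token.endInstance] ++
    D.pairs.flatMap (fun p => encodeFact p.1 ++ encodeFact p.2)

/-! ### coNP-hardness -/

/-- Bit strings. -/
abbrev Str : Type := List Bool

/-- A pair of bit strings is written with a separator between its components. -/
def encodePair (p : Str × Str) : List (Option Bool) :=
  p.1.map some ++ none :: p.2.map some

/-- `f` is computable in polynomial time by a (multi-stack) Turing machine, with respect to the
given encodings of the arguments and of the values. -/
def PolyTime {α β Γ₀ Γ₁ : Type} (ea : α → List Γ₀) (eb : β → List Γ₁) (f : α → β) : Prop :=
  Nonempty (Turing.TM2ComputableInPolyTime ea eb f)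

/-- `L` is in NP: membership has certificates of polynomial length that a polynomial-time
verifier can check. -/
def InNP (L : Set Str) : Prop :=
  ∃ (V : Str × Str → Bool) (p : Polynomial ℕ),
    PolyTime encodePair Computability.encodeBool V ∧
    ∀ x, x ∈ L ↔ ∃ w : Str, w.length ≤ p.eval x.length ∧ V (x, w) = true

/-- `L` is in coNP: its complement is in NP. -/
def InCoNP (L : Set Str) : Prop := InNP Lᶜ

/-- The decision problem with yes-instances `P`, and with inputs written by means of `enc`, is
coNP-hard: every language in coNP has a polynomial-time many-one reduction to it. -/
def CoNPHard {α Γ : Type} (enc : α → List Γ) (P : Set α) : Prop :=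
  ∀ L : Set Str, InCoNP L →
    ∃ f : Str → α, PolyTime (id : Str → List Bool) enc f ∧ ∀ x, x ∈ L ↔ f x ∈ P

/-- The problem g-categoricity over the schema `S` is coNP-hard. -/
def GCategoricityCoNPHard (S : Schema) : Prop :=
  CoNPHard (encodeInput (S := S)) (GCategoricity S)

end CleanDB

/-!
The schema `S⁰` itself is not equivalent to a single dependency, which gives one implication. For
the other one, let `R` be a relation symbol whose dependencies are not equivalent to a single one,
and call a set `Z` of attributes violating if two facts over `R` that agree exactly on `Z` conflict.
If two violating sets `P`, `Q` have a non-violating intersection, then writing the first constant of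
a binary fact outside `Q` and the second one outside `P` embeds the inputs over `S⁰` into those over
`S`, with the same conflicts.

Otherwise there is a least violating set `X₀`. The dependencies are not equivalent to `X₀ → Y₀`,
where `Y₀` is the closure of `X₀`, hence some set `X₁ ⊇ Y₀` is violating. The attributes in `X₀`
and `Y₀` now separate three pairwise conflicting blocks of facts, and those in `X₁` arrange the
facts of a block in groups of pairwise conflicting facts. Sets of facts from the first block guess
two distinct optimal sets of the given input, those from the second block guess a reason why such a
pair fails (an improvement, an inconsistency, or an inclusion of one set in the other), and the last
block is a single fact that has priority over the second block. This fact alone is optimal, and it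
is the only optimal set if and only if every pair of guesses is refuted, which holds if and only if
the given input has just one optimal set.

In both cases, each fact of the new input is computed from one fact or one priority by copying
constants into fixed positions, so the new input is a concatenation of images under finite-state
maps, and a stack machine computes it by post-processing the output of the given reduction.
-/

namespace CleanDB

/-! ### Post-processing the output of a Turing machine -/

section PostProcessing

open Turing Function

section StackGrowth

variable {K Λ σ : Type*} {Γ : K → Type*}

/-- The number of `push` operations in a statement. It bounds how much a stack can grow when the
statement is executed. -/
def pushCount : TM2.Stmt Γ Λ σ → ℕ
  | .push _ _ q => pushCount q + 1
  | .peek _ _ q => pushCount q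
  | .pop _ _ q => pushCount q
  | .load _ q => pushCount q
  | .branch _ q₁ q₂ => pushCount q₁ + pushCount q₂
  | .goto _ => 0
  | .halt => 0

lemma length_stk_stepAux_le [DecidableEq K] (s : TM2.Stmt Γ Λ σ) (v : σ)
    (S : ∀ k, List (Γ k)) (k : K) :
    ((TM2.stepAux s v S).stk k).length ≤ (S k).length + pushCount s := by
  induction s generalizing v S with
  | push k' f q ih =>
    refine (ih _ _).trans ?_
    rcases eq_or_ne k k' with rfl | h
    · simp only [update_self, List.length_cons, pushCount]; omega
    · simp only [update_of_ne h, pushCount]; omega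
  | peek k' f _ ih => exact ih _ _
  | pop k' f q ih =>
    refine (ih _ _).trans ?_
    rcases eq_or_ne k k' with rfl | h
    · simp only [update_self, List.length_tail, pushCount]; omega
    · simp only [update_of_ne h, pushCount]; omega
  | load f _ ih => exact ih _ _
  | branch f q₁ q₂ ih₁ ih₂ =>
    simp only [TM2.stepAux, pushCount]
    cases f v
    · exact (ih₂ v S).trans (by omega)
    · exact (ih₁ v S).trans (by omega)
  | goto f => exact Nat.le_add_right _ _
  | halt => exact Nat.le_add_right _ _

end StackGrowth

lemma iterate_flip_bind_none {α : Type*} (f : α → Option α) (n : ℕ) :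
    (flip bind f)^[n] none = none :=
  iterate_fixed rfl n

lemma exists_of_iterate_flip_bind_succ {α : Type*} {f : α → Option α} {n : ℕ} {a b : α}
    (h : (flip bind f)^[n + 1] (some a) = some b) :
    ∃ c, f a = some c ∧ (flip bind f)^[n] (some c) = some b := by
  change (flip bind f)^[n] (f a) = some b at h
  cases hc : f a with
  | none =>
    rw [hc, iterate_flip_bind_none] at h
    cases h
  | some c => exact ⟨c, rfl, hc ▸ h⟩

lemma exists_of_step_eq_some {tm : FinTM2} {c d : tm.Cfg} (h : tm.step c = some d) :
    ∃ l, c.l = some l ∧ d = TM2.stepAux (tm.m l) c.var c.stk := by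
  obtain ⟨_ | l, v, S⟩ := c
  · cases h
  · exact ⟨l, rfl, (Option.some.inj h).symm⟩

lemma length_stk_le_of_iterate_step {tm : FinTM2} {B : ℕ} (hB : ∀ l, pushCount (tm.m l) ≤ B)
    (k : tm.K) {n : ℕ} {c c' : tm.Cfg} (h : (flip bind tm.step)^[n] (some c) = some c') :
    (c'.stk k).length ≤ (c.stk k).length + B * n := by
  induction n generalizing c with
  | zero => cases h; exact Nat.le_add_right _ _
  | succ n ih =>
    obtain ⟨d, hd, h⟩ := exists_of_iterate_flip_bind_succ h
    obtain ⟨l, -, rfl⟩ := exists_of_step_eq_some hd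
    calc (c'.stk k).length
        ≤ ((TM2.stepAux (tm.m l) c.var c.stk).stk k).length + B * n := ih h
      _ ≤ (c.stk k).length + B + B * n := by
        gcongr
        exact (length_stk_stepAux_le _ _ _ _).trans (Nat.add_le_add_left (hB l) _)
      _ = (c.stk k).length + B * (n + 1) := by ring

lemma stk_haltList_self (tm : FinTM2) (w : List (tm.Γ tm.k₁)) :
    (haltList tm w).stk tm.k₁ = w := by
  simp [haltList]

lemma update_stk_haltList (tm : FinTM2) (w w' : List (tm.Γ tm.k₁)) :
    update (haltList tm w).stk tm.k₁ w' = (haltList tm w').stk := by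
  funext k
  rcases eq_or_ne k tm.k₁ with rfl | h
  · rw [update_self, stk_haltList_self]
  · simp [haltList, h]

lemma length_stk_initList_le (tm : FinTM2) (w : List (tm.Γ tm.k₀)) (k : tm.K) :
    ((initList tm w).stk k).length ≤ w.length := by
  rcases eq_or_ne k tm.k₀ with rfl | h
  · simp [initList]
  · simp [initList, h]

lemma length_output_le {tm : FinTM2} {B : ℕ} (hB : ∀ l, pushCount (tm.m l) ≤ B) {n : ℕ}
    {w : List (tm.Γ tm.k₀)} {w' : List (tm.Γ tm.k₁)} (h : TM2OutputsInTime tm w (some w') n) :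
    w'.length ≤ w.length + B * n := by
  obtain ⟨⟨m, hm⟩, hmn⟩ := h
  have hlen := length_stk_le_of_iterate_step hB tm.k₁ hm
  rw [stk_haltList_self] at hlen
  exact hlen.trans (add_le_add (length_stk_initList_le ..) (Nat.mul_le_mul_left _ hmn))

/-- A string transformation that runs in linear time on a machine with stacks: a finite automaton
annotates every letter of the input with the state in which the letter is read; the annotated
string is cut into blocks in front of the letters accepted by `isStart`; each block is then
replaced by the concatenation of its images under the homomorphisms `passes`. -/
structure PostProc (Q Γ₁ Γ₂ : Type*) where
  init : Q
  next : Q → Γ₁ → Q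
  isStart : Q × Γ₁ → Bool
  passes : List (Q × Γ₁ → List Γ₂)

namespace PostProc

section Transformation

variable {Q Γ₁ Γ₂ : Type*} (P : PostProc Q Γ₁ Γ₂)

/-- The input annotated with the states of the automaton, started in state `q`. -/
def annotate (P : PostProc Q Γ₁ Γ₂) : Q → List Γ₁ → List (Q × Γ₁)
  | _, [] => []
  | q, γ :: w => (q, γ) :: P.annotate (P.next q γ) w

lemma length_annotate (q : Q) (w : List Γ₁) : (P.annotate q w).length = w.length := by
  induction w generalizing q with
  | nil => rfl
  | cons γ w ih => exact congrArg (· + 1) (ih _)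

/-- The image of a block under the first `j` passes. -/
def imageTake (j : ℕ) (b : List (Q × Γ₁)) : List Γ₂ :=
  (P.passes.take j).flatMap fun h => b.flatMap h

/-- The image of a block. -/
def image (b : List (Q × Γ₁)) : List Γ₂ :=
  P.passes.flatMap fun h => b.flatMap h

variable {P}

lemma imageTake_succ (j : Fin P.passes.length) (b : List (Q × Γ₁)) :
    P.imageTake (j + 1) b = P.imageTake j b ++ b.flatMap P.passes[j] := by
  rw [imageTake, List.take_add_one, List.getElem?_eq_getElem j.2, List.flatMap_append, imageTake]
  simp

variable (P) in
/-- A block starts with a letter accepted by `isStart`, and has no other such letter. -/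
def IsBlock (b : List (Q × Γ₁)) : Prop :=
  ∃ c l, b = c :: l ∧ P.isStart c = true ∧ ∀ x ∈ l, P.isStart x = false

end Transformation

/-- The stacks used for post-processing, in addition to those of the machine whose output is
post-processed: the letters that are not yet processed, the current block (on one of two stacks),
and the output. -/
inductive Stack
  | todo
  | block
  | aux
  | out
  deriving DecidableEq

instance : Fintype Stack :=
  ⟨{.todo, .block, .aux, .out}, fun x => by cases x <;> decide⟩

/-- The labels used for post-processing with `m` passes. The output is moved to the stack `todo` by
`read` and `keep`. The last block is then moved to the stack `block` by `collect` and `stash`. Each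
pass over the block moves it to the stack `aux`, by `down` and `downPush`, and back, by `up` and
`upPush`, while its image is written. After the passes, the block is erased by `clear`. -/
inductive Label (Q Γ₁ : Type) (m : ℕ)
  | read (q : Q)
  | keep (q : Q) (γ : Γ₁)
  | collect
  | stash (x : Q × Γ₁)
  | down (j : Fin m)
  | downPush (j : Fin m) (x : Q × Γ₁)
  | up (j : Fin m)
  | upPush (j : Fin m) (x : Q × Γ₁)
  | clear
  | finish
  deriving Fintype

/-- The stack alphabets of the extended machine. -/
abbrev StackAlphabet (Q Γ₁ Γ₂ : Type) (tm : FinTM2) : tm.K ⊕ Stack → Type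
  | .inl k => tm.Γ k
  | .inr .todo => Q × Γ₁
  | .inr .block => Q × Γ₁
  | .inr .aux => Q × Γ₁
  | .inr .out => Γ₂

/-- The contents of the stacks of the extended machine. -/
structure Store (Q Γ₁ Γ₂ : Type) (tm : FinTM2) where
  old : ∀ k, List (tm.Γ k)
  todo : List (Q × Γ₁) := []
  block : List (Q × Γ₁) := []
  aux : List (Q × Γ₁) := []
  out : List Γ₂ := []

namespace Store

variable {Q Γ₁ Γ₂ : Type} {tm : FinTM2} (T : Store Q Γ₁ Γ₂ tm)

/-- The contents of the stacks, as a family indexed by the stacks. -/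
def stk : ∀ k, List (StackAlphabet Q Γ₁ Γ₂ tm k)
  | .inl k => T.old k
  | .inr .todo => T.todo
  | .inr .block => T.block
  | .inr .aux => T.aux
  | .inr .out => T.out

lemma update_old (k : tm.K) (x : List (tm.Γ k)) :
    update T.stk (.inl k) x = { T with old := update T.old k x }.stk := by
  funext i
  rcases i with i | _ | _ | _ | _
  · rcases eq_or_ne i k with rfl | h
    · simp [stk]
    · simp [stk, update_of_ne h, update_of_ne (Sum.inl_injective.ne h)]
  all_goals rfl

lemma update_todo (x : List (Q × Γ₁)) :
    update T.stk (.inr .todo) x = { T with todo := x }.stk := by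
  funext i
  rcases i with i | _ | _ | _ | _ <;> rfl

lemma update_block (x : List (Q × Γ₁)) :
    update T.stk (.inr .block) x = { T with block := x }.stk := by
  funext i
  rcases i with i | _ | _ | _ | _ <;> rfl

lemma update_aux (x : List (Q × Γ₁)) :
    update T.stk (.inr .aux) x = { T with aux := x }.stk := by
  funext i
  rcases i with i | _ | _ | _ | _ <;> rfl

lemma update_out (x : List Γ₂) :
    update T.stk (.inr .out) x = { T with out := x }.stk := by
  funext i
  rcases i with i | _ | _ | _ | _ <;> rfl

end Store

section Machine

variable {Q Γ₁ Γ₂ : Type} (P : PostProc Q Γ₁ Γ₂) (tm : FinTM2) (e : tm.Γ tm.k₁ ≃ Γ₁)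

/-- The labels of the post-processing phase for `P`. -/
abbrev PostLabel : Type := Label Q Γ₁ P.passes.length

/-- The statements of the extended machine. Its internal state is a state of `tm`, together with a
label that records what was popped last. -/
abbrev Stmt : Type :=
  TM2.Stmt (StackAlphabet Q Γ₁ Γ₂ tm) (tm.Λ ⊕ P.PostLabel) (tm.σ × P.PostLabel)

/-- The configurations of the extended machine. -/
abbrev Cfg : Type :=
  TM2.Cfg (StackAlphabet Q Γ₁ Γ₂ tm) (tm.Λ ⊕ P.PostLabel) (tm.σ × P.PostLabel)

/-- A statement of `tm`, as one of the extended machine: instead of halting, it starts the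
post-processing. -/
def liftStmt : TM2.Stmt tm.Γ tm.Λ tm.σ → P.Stmt tm
  | .push k f q => .push (.inl k) (fun v => f v.1) (liftStmt q)
  | .peek k f q => .peek (.inl k) (fun v o => (f v.1 o, v.2)) (liftStmt q)
  | .pop k f q => .pop (.inl k) (fun v o => (f v.1 o, v.2)) (liftStmt q)
  | .load f q => .load (fun v => (f v.1, v.2)) (liftStmt q)
  | .branch f q₁ q₂ => .branch (fun v => f v.1) (liftStmt q₁) (liftStmt q₂)
  | .goto f => .goto fun v => .inl (f v.1)
  | .halt => .goto fun _ => .inr (.read P.init)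

variable {P tm} in
/-- Pop a letter from stack `k`, and jump to a label that depends on the letter. -/
def popGoto (k : tm.K ⊕ Stack) (F : Option (StackAlphabet Q Γ₁ Γ₂ tm k) → P.PostLabel) :
    P.Stmt tm :=
  .pop k (fun v o => (v.1, F o)) (.goto fun v => .inr v.2)

variable {P tm} in
/-- Push the letter `x` onto stack `k`, and jump to the label `l`. -/
def pushGoto (k : tm.K ⊕ Stack) (x : StackAlphabet Q Γ₁ Γ₂ tm k) (l : P.PostLabel) :
    P.Stmt tm :=
  .push k (fun _ => x) (.goto fun _ => .inr l)

variable {P tm} in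
/-- Push the letters of a word onto the output stack, the last one first, and proceed with `s`. -/
def write (w : List Γ₂) (s : P.Stmt tm) : P.Stmt tm :=
  w.foldl (fun s y => .push (.inr .out) (fun _ => y) s) s

/-- The label at which `j` more passes over the current block are started. -/
def enter (j : Fin (P.passes.length + 1)) : P.PostLabel :=
  Fin.cases .clear .down j

/-- The program of the post-processing phase. The blocks, and the passes over each of them, are
processed from last to first, because stacks are written from right to left. -/
def program : P.PostLabel → P.Stmt tm
  | .read q => popGoto (.inl tm.k₁) fun o => o.elim .collect fun γ => .keep q (e γ)
  | .keep q γ => pushGoto (.inr .todo) (q, γ) (.read (P.next q γ))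
  | .collect => popGoto (.inr .todo) fun o => o.elim .finish .stash
  | .stash x => pushGoto (.inr .block) x (if P.isStart x then P.enter (Fin.last _) else .collect)
  | .down j => popGoto (.inr .block) fun o => o.elim (.up j) (.downPush j)
  | .downPush j x => pushGoto (.inr .aux) x (.down j)
  | .up j => popGoto (.inr .aux) fun o => o.elim (P.enter j.castSucc) (.upPush j)
  | .upPush j x => write (P.passes[j] x) (pushGoto (.inr .block) x (.up j))
  | .clear => popGoto (.inr .block) fun o => o.elim .collect fun _ => .clear
  | .finish => .load (fun _ => (tm.initialState, .read P.init)) .halt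

/-- The machine that runs `tm` and then post-processes its output. -/
def machine [Fintype Q] [Fintype Γ₁] : FinTM2 :=
  letI := tm.kDecidableEq
  letI := tm.kFin
  letI := tm.ΛFin
  letI := tm.σFin
  { K := tm.K ⊕ Stack
    k₀ := .inl tm.k₀
    k₁ := .inr .out
    Γ := StackAlphabet Q Γ₁ Γ₂ tm
    Λ := tm.Λ ⊕ P.PostLabel
    main := .inl tm.main
    σ := tm.σ × P.PostLabel
    initialState := (tm.initialState, .read P.init)
    Γk₀Fin := tm.Γk₀Fin
    m := Sum.elim (fun l => P.liftStmt tm (tm.m l)) (P.program tm e) }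

/-- A configuration of `tm`, as one of the extended machine. -/
def liftCfg (p : P.PostLabel) (c : tm.Cfg) : P.Cfg tm :=
  ⟨some (c.l.elim (.inr (.read P.init)) .inl), (c.var, p), Store.stk { old := c.stk }⟩

lemma stepAux_liftStmt (p : P.PostLabel) (s : TM2.Stmt tm.Γ tm.Λ tm.σ) (v : tm.σ)
    (S : ∀ k, List (tm.Γ k)) :
    TM2.stepAux (P.liftStmt tm s) (v, p) (Store.stk { old := S }) =
      P.liftCfg tm p (TM2.stepAux s v S) := by
  induction s generalizing v S with
  | push k f q ih => simp only [liftStmt, TM2.stepAux, Store.update_old]; exact ih _ _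
  | peek k f _ ih => exact ih _ _
  | pop k f q ih => simp only [liftStmt, TM2.stepAux, Store.update_old]; exact ih _ _
  | load f _ ih => exact ih _ _
  | branch f q₁ q₂ ih₁ ih₂ =>
    simp only [liftStmt, TM2.stepAux]
    cases f v
    · exact ih₂ _ _
    · exact ih₁ _ _
  | goto f => rfl
  | halt => rfl

lemma stepAux_write (w : List Γ₂) (s : P.Stmt tm) (v : tm.σ × P.PostLabel)
    (T : Store Q Γ₁ Γ₂ tm) :
    TM2.stepAux (write w s) v T.stk = TM2.stepAux s v { T with out := w ++ T.out }.stk := by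
  induction w generalizing s with
  | nil => rfl
  | cons y w ih =>
    refine (ih _).trans ?_
    simp only [TM2.stepAux, Store.update_out]
    rfl

variable [Fintype Q] [Fintype Γ₁]

lemma iterate_step_liftCfg (p : P.PostLabel) {n : ℕ} {c c' : tm.Cfg}
    (h : (flip bind tm.step)^[n] (some c) = some c') :
    (flip bind (P.machine tm e).step)^[n] (some (P.liftCfg tm p c)) =
      some (P.liftCfg tm p c') := by
  induction n generalizing c with
  | zero => cases h; rfl
  | succ n ih =>
    obtain ⟨d, hd, h⟩ := exists_of_iterate_flip_bind_succ h
    obtain ⟨l, hl, rfl⟩ := exists_of_step_eq_some hd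
    have hstep : (P.machine tm e).step (P.liftCfg tm p c) =
        some (P.liftCfg tm p (TM2.stepAux (tm.m l) c.var c.stk)) := by
      rw [← stepAux_liftStmt, liftCfg, hl]
      rfl
    exact (congrArg (flip bind (P.machine tm e).step)^[n] hstep).trans (ih h)

/-- A configuration of the post-processing phase. -/
def cfg (l p : P.PostLabel) (T : Store Q Γ₁ Γ₂ tm) : P.Cfg tm :=
  ⟨some (.inr l), (tm.initialState, p), T.stk⟩

/-- From label `l` with stack contents `T`, the extended machine reaches label `l'` with stack
contents `T'` within `n` steps. -/
def Run (n : ℕ) (l : P.PostLabel) (T : Store Q Γ₁ Γ₂ tm) (l' : P.PostLabel)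
    (T' : Store Q Γ₁ Γ₂ tm) : Prop :=
  ∀ p, ∃ p', Nonempty (StateTransition.EvalsToInTime (P.machine tm e).step
    (P.cfg tm l p T) (some (P.cfg tm l' p' T')) n)

end Machine

section Run

variable {Q Γ₁ Γ₂ : Type} {P : PostProc Q Γ₁ Γ₂} {tm : FinTM2} {e : tm.Γ tm.k₁ ≃ Γ₁}
variable [Fintype Q] [Fintype Γ₁] {n n₁ n₂ : ℕ} {l l' l'' : P.PostLabel}
variable {T T' T'' : Store Q Γ₁ Γ₂ tm}

lemma Run.mono (h : P.Run tm e n₁ l T l' T') (hn : n₁ ≤ n) : P.Run tm e n l T l' T' := fun p => by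
  obtain ⟨p', ⟨t⟩⟩ := h p
  exact ⟨p', ⟨⟨t.toEvalsTo, t.steps_le_m.trans hn⟩⟩⟩

lemma Run.trans (h₁ : P.Run tm e n₁ l T l' T') (h₂ : P.Run tm e n₂ l' T' l'' T'') :
    P.Run tm e (n₁ + n₂) l T l'' T'' := fun p => by
  obtain ⟨p', ⟨t₁⟩⟩ := h₁ p
  obtain ⟨p'', ⟨t₂⟩⟩ := h₂ p'
  exact ⟨p'', ⟨(t₁.trans _ _ _ _ _ _ t₂).toEvalsTo, by
    have := (t₁.trans _ _ _ _ _ _ t₂).steps_le_m; omega⟩⟩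

lemma Run.refl (l : P.PostLabel) (T : Store Q Γ₁ Γ₂ tm) : P.Run tm e 0 l T l T :=
  fun p => ⟨p, ⟨StateTransition.EvalsToInTime.refl _ _⟩⟩

lemma Run.step
    (h : ∀ p, ∃ p', TM2.stepAux (P.program tm e l) (tm.initialState, p) T.stk = P.cfg tm l' p' T') :
    P.Run tm e 1 l T l' T' := fun p => by
  obtain ⟨p', hp⟩ := h p
  exact ⟨p', ⟨⟨⟨1, congrArg some hp⟩, le_rfl⟩⟩⟩

lemma Run.pop {k : tm.K ⊕ Stack} {F : Option (StackAlphabet Q Γ₁ Γ₂ tm k) → P.PostLabel}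
    (hl : P.program tm e l = popGoto k F) (hT : update T.stk k (T.stk k).tail = T'.stk)
    (hF : F (T.stk k).head? = l') :
    P.Run tm e 1 l T l' T' :=
  .step fun _ => ⟨l', by simp only [hl, popGoto, TM2.stepAux, hT, hF]; rfl⟩

lemma Run.push {k : tm.K ⊕ Stack} {x : StackAlphabet Q Γ₁ Γ₂ tm k}
    (hl : P.program tm e l = pushGoto k x l') (hT : update T.stk k (x :: T.stk k) = T'.stk) :
    P.Run tm e 1 l T l' T' :=
  .step fun p => ⟨p, by simp only [hl, pushGoto, TM2.stepAux, hT]; rfl⟩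

lemma run_read (q : Q) (w : List (tm.Γ tm.k₁)) (A : List (Q × Γ₁)) :
    P.Run tm e (2 * w.length + 1) (.read q) { old := (haltList tm w).stk, todo := A }
      .collect { old := (haltList tm []).stk, todo := (P.annotate q (w.map e)).reverse ++ A } := by
  induction w generalizing q A with
  | nil =>
    refine .pop rfl ((Store.update_old ..).trans ?_) ?_ <;> simp only [Store.stk, stk_haltList_self]
    · simp only [update_stk_haltList]; rfl
    · rfl
  | cons x w ih =>
    have hpop : P.Run tm e 1 (.read q) { old := (haltList tm (x :: w)).stk, todo := A }
        (.keep q (e x)) { old := (haltList tm w).stk, todo := A } := by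
      refine .pop rfl ((Store.update_old ..).trans ?_) ?_ <;>
        simp only [Store.stk, stk_haltList_self]
      · simp only [update_stk_haltList]; rfl
      · rfl
    have hpush : P.Run tm e 1 (.keep q (e x)) { old := (haltList tm w).stk, todo := A }
        (.read (P.next q (e x))) { old := (haltList tm w).stk, todo := (q, e x) :: A } :=
      .push rfl (Store.update_todo ..)
    have h := ((hpop.trans hpush).trans (ih (P.next q (e x)) ((q, e x) :: A))).mono
      (n := 2 * (x :: w).length + 1) (by rw [List.length_cons]; omega)
    simpa [annotate] using h

variable (S : ∀ k, List (tm.Γ k)) (A : List (Q × Γ₁))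

lemma run_down (j : Fin P.passes.length) (C D : List (Q × Γ₁)) (O : List Γ₂) :
    P.Run tm e (2 * C.length + 1)
      (.down j) { old := S, todo := A, block := C, aux := D, out := O }
      (.up j) { old := S, todo := A, aux := C.reverse ++ D, out := O } := by
  induction C generalizing D with
  | nil => exact .pop rfl (Store.update_block ..) rfl
  | cons x C ih =>
    have hpop : P.Run tm e 1
        (.down j) { old := S, todo := A, block := x :: C, aux := D, out := O }
        (.downPush j x) { old := S, todo := A, block := C, aux := D, out := O } :=
      .pop rfl (Store.update_block ..) rfl
    have hpush : P.Run tm e 1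
        (.downPush j x) { old := S, todo := A, block := C, aux := D, out := O }
        (.down j) { old := S, todo := A, block := C, aux := x :: D, out := O } :=
      .push rfl (Store.update_aux ..)
    have h := ((hpop.trans hpush).trans (ih (x :: D))).mono
      (n := 2 * (x :: C).length + 1) (by rw [List.length_cons]; omega)
    simpa using h

lemma run_up (j : Fin P.passes.length) (C D : List (Q × Γ₁)) (O : List Γ₂) :
    P.Run tm e (2 * D.length + 1)
      (.up j) { old := S, todo := A, block := C, aux := D, out := O }
      (P.enter j.castSucc)
      { old := S, todo := A, block := D.reverse ++ C,
        out := D.reverse.flatMap P.passes[j] ++ O } := by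
  induction D generalizing C O with
  | nil => exact .pop rfl (Store.update_aux ..) rfl
  | cons x D ih =>
    have hpop : P.Run tm e 1
        (.up j) { old := S, todo := A, block := C, aux := x :: D, out := O }
        (.upPush j x) { old := S, todo := A, block := C, aux := D, out := O } :=
      .pop rfl (Store.update_aux ..) rfl
    have hwrite : P.Run tm e 1
        (.upPush j x) { old := S, todo := A, block := C, aux := D, out := O }
        (.up j) { old := S, todo := A, block := x :: C, aux := D, out := P.passes[j] x ++ O } :=
      .step fun p => ⟨p, (stepAux_write ..).trans
        (by simp only [pushGoto, TM2.stepAux, Store.update_block]; rfl)⟩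
    have h := ((hpop.trans hwrite).trans (ih (x :: C) (P.passes[j] x ++ O))).mono
      (n := 2 * (x :: D).length + 1) (by rw [List.length_cons]; omega)
    simpa using h

lemma run_clear (C : List (Q × Γ₁)) (O : List Γ₂) :
    P.Run tm e (C.length + 1) .clear { old := S, todo := A, block := C, out := O }
      .collect { old := S, todo := A, out := O } := by
  induction C with
  | nil => exact .pop rfl (Store.update_block ..) rfl
  | cons x C ih =>
    have hpop : P.Run tm e 1 .clear { old := S, todo := A, block := x :: C, out := O }
        .clear { old := S, todo := A, block := C, out := O } :=
      .pop rfl (Store.update_block ..) rfl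
    exact (hpop.trans ih).mono (by rw [List.length_cons]; omega)

lemma run_enter (j : Fin (P.passes.length + 1)) (b : List (Q × Γ₁)) (O : List Γ₂) :
    P.Run tm e (j * (4 * b.length + 2) + (b.length + 1))
      (P.enter j) { old := S, todo := A, block := b, out := O }
      .collect { old := S, todo := A, out := P.imageTake j b ++ O } := by
  induction j using Fin.induction generalizing O with
  | zero => exact (run_clear S A b O).mono (Nat.le_add_left _ _)
  | succ j ih =>
    have hsweep := (run_down (P := P) (e := e) S A j b [] O).trans (run_up S A j [] _ O)
    simp only [List.append_nil, List.reverse_reverse, List.length_reverse] at hsweep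
    rw [Fin.val_succ, imageTake_succ, List.append_assoc]
    exact (hsweep.trans (ih _)).mono (by rw [Fin.val_castSucc, Nat.add_mul]; omega)

lemma run_collect (C b : List (Q × Γ₁)) (O : List Γ₂) (hb : ∀ x ∈ b, P.isStart x = false) :
    P.Run tm e (2 * b.length) .collect { old := S, todo := b ++ A, block := C, out := O }
      .collect { old := S, todo := A, block := b.reverse ++ C, out := O } := by
  induction b generalizing C with
  | nil => exact .refl _ _
  | cons x b ih =>
    have hpop : P.Run tm e 1
        .collect { old := S, todo := x :: b ++ A, block := C, out := O }
        (.stash x) { old := S, todo := b ++ A, block := C, out := O } :=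
      .pop rfl (Store.update_todo ..) rfl
    have hpush : P.Run tm e 1
        (.stash x) { old := S, todo := b ++ A, block := C, out := O }
        .collect { old := S, todo := b ++ A, block := x :: C, out := O } :=
      .push (by rw [program, hb x List.mem_cons_self]; rfl) (Store.update_block ..)
    have h := ((hpop.trans hpush).trans
      (ih (x :: C) fun y hy => hb y (List.mem_cons_of_mem _ hy))).mono
      (n := 2 * (x :: b).length) (by rw [List.length_cons]; omega)
    simpa using h

lemma run_block (b : List (Q × Γ₁)) (O : List Γ₂) (hb : P.IsBlock b) :
    P.Run tm e (b.length * (6 * P.passes.length + 4))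
      .collect { old := S, todo := b.reverse ++ A, out := O }
      .collect { old := S, todo := A, out := P.image b ++ O } := by
  obtain ⟨c, b, rfl, hc, hb⟩ := hb
  have hcollect := run_collect (P := P) (e := e) S (c :: A) [] b.reverse O (by simpa using hb)
  have hpop : P.Run tm e 1 .collect { old := S, todo := c :: A, block := b, out := O }
      (.stash c) { old := S, todo := A, block := b, out := O } :=
    .pop rfl (Store.update_todo ..) rfl
  have hpush : P.Run tm e 1 (.stash c) { old := S, todo := A, block := b, out := O }
      (P.enter (Fin.last _)) { old := S, todo := A, block := c :: b, out := O } :=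
    .push (by rw [program, hc]; rfl) (Store.update_block ..)
  have hpasses := run_enter (P := P) (e := e) S A (Fin.last _) (c :: b) O
  simp only [List.reverse_reverse, List.append_nil, List.length_reverse] at hcollect
  have himage : P.imageTake (Fin.last P.passes.length) (c :: b) = P.image (c :: b) := by
    rw [imageTake, Fin.val_last, List.take_length, image]
  rw [himage] at hpasses
  rw [List.reverse_cons, List.append_assoc]
  refine (((hcollect.trans hpop).trans hpush).trans hpasses).mono ?_
  rw [List.length_cons, Fin.val_last]
  nlinarith [Nat.zero_le (b.length * P.passes.length)]

lemma run_blocks (bs : List (List (Q × Γ₁))) (hbs : ∀ b ∈ bs, P.IsBlock b) (O : List Γ₂) :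
    P.Run tm e (bs.flatten.length * (6 * P.passes.length + 4))
      .collect { old := S, todo := bs.flatten.reverse, out := O }
      .collect { old := S, out := bs.flatMap P.image ++ O } := by
  induction bs using List.reverseRecOn generalizing O with
  | nil => exact (Run.refl _ _).mono (Nat.zero_le _)
  | append_singleton bs b ih =>
    have h := (run_block (P := P) (e := e) S bs.flatten.reverse b O (hbs b (by simp))).trans
      (ih (fun b' hb' => hbs b' (by simp [hb'])) _)
    simp only [List.flatten_append, List.flatten_cons, List.flatten_nil, List.append_nil,
      List.reverse_append, List.flatMap_append, List.flatMap_cons, List.flatMap_nil,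
      List.append_assoc, List.length_append] at h ⊢
    exact h.mono (by rw [Nat.add_mul]; omega)

lemma run_read_finish (w : List (tm.Γ tm.k₁)) (bs : List (List (Q × Γ₁)))
    (hw : P.annotate P.init (w.map e) = bs.flatten) (hbs : ∀ b ∈ bs, P.IsBlock b) :
    P.Run tm e (w.length * (6 * P.passes.length + 6) + 2)
      (.read P.init) { old := (haltList tm w).stk }
      .finish { old := (haltList tm []).stk, out := bs.flatMap P.image } := by
  have hread := run_read (P := P) (e := e) P.init w []
  have hblocks := run_blocks (P := P) (e := e) (haltList tm []).stk bs hbs []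
  have hpop : P.Run tm e 1
      .collect { old := (haltList tm []).stk, out := bs.flatMap P.image }
      .finish { old := (haltList tm []).stk, out := bs.flatMap P.image } :=
    .pop rfl (Store.update_todo ..) rfl
  have hlen : bs.flatten.length = w.length := by
    rw [← hw, length_annotate, List.length_map]
  rw [hw, List.append_nil] at hread
  rw [hlen, List.append_nil] at hblocks
  exact ((hread.trans hblocks).trans hpop).mono (le_of_eq (by ring))

lemma initList_machine (w : List (tm.Γ tm.k₀)) :
    initList (P.machine tm e) w = P.liftCfg tm (.read P.init) (initList tm w) := by
  unfold initList liftCfg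
  congr 1
  funext k
  rcases k with k | k
  · rcases eq_or_ne k tm.k₀ with rfl | h
    · simp only [Store.stk, dif_pos]
      exact dif_pos rfl
    · simp only [Store.stk, dif_neg h]
      exact dif_neg fun h' => h (Sum.inl.inj h')
  · cases k <;> exact dif_neg (by rintro ⟨⟩)

lemma haltList_machine (w : List Γ₂) :
    haltList (P.machine tm e) w = (⟨none, (tm.initialState, .read P.init),
      Store.stk { old := (haltList tm []).stk, out := w }⟩ : P.Cfg tm) := by
  unfold haltList
  congr 1
  funext k
  rcases k with k | _ | _ | _ | _
  · rw [dif_neg (by rintro ⟨⟩)]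
    rcases eq_or_ne k tm.k₁ with rfl | h
    · simp [Store.stk]; rfl
    · simp [Store.stk, h]; rfl
  · exact dif_neg (by rintro ⟨⟩)
  · exact dif_neg (by rintro ⟨⟩)
  · exact dif_neg (by rintro ⟨⟩)
  · exact dif_pos rfl

theorem outputsInTime_machine {w : List (tm.Γ tm.k₀)} {w' : List (tm.Γ tm.k₁)}
    (h : TM2OutputsInTime tm w (some w') n) (bs : List (List (Q × Γ₁)))
    (hw' : P.annotate P.init (w'.map e) = bs.flatten) (hbs : ∀ b ∈ bs, P.IsBlock b) :
    Nonempty (TM2OutputsInTime (P.machine tm e) w (some (bs.flatMap P.image))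
      (n + w'.length * (6 * P.passes.length + 6) + 3)) := by
  obtain ⟨⟨m, hm⟩, hmn⟩ := h
  have hrun : StateTransition.EvalsToInTime (P.machine tm e).step (initList (P.machine tm e) w)
      (some (P.liftCfg tm (.read P.init) (haltList tm w'))) n :=
    ⟨⟨m, (congrArg (fun c => (flip bind (P.machine tm e).step)^[m] (some c))
      (initList_machine w)).trans (P.iterate_step_liftCfg tm e (.read P.init) hm)⟩, hmn⟩
  obtain ⟨p, ⟨hpost⟩⟩ := run_read_finish (P := P) (e := e) w' bs hw' hbs (.read P.init)
  have hhalt : StateTransition.EvalsToInTime (P.machine tm e).step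
      (P.cfg tm .finish p { old := (haltList tm []).stk, out := bs.flatMap P.image })
      (some (haltList (P.machine tm e) (bs.flatMap P.image))) 1 :=
    ⟨⟨1, congrArg some (haltList_machine _).symm⟩, le_rfl⟩
  have hall := (hrun.trans _ _ _ _ _ _ hpost).trans _ _ _ _ _ _ hhalt
  exact ⟨⟨hall.toEvalsTo, hall.steps_le_m.trans (by omega)⟩⟩

end Run

end PostProc

theorem PolyTime.postProc {α β β' Γ₀ Γ₁ Γ₂ Q : Type} [Finite Γ₁] [Finite Q]
    {ea : α → List Γ₀} {eb : β → List Γ₁} {eb' : β' → List Γ₂} {f : α → β} {f' : α → β'}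
    (hf : PolyTime ea eb f) (P : PostProc Q Γ₁ Γ₂) (blocks : α → List (List (Q × Γ₁)))
    (hblocks : ∀ a, P.annotate P.init (eb (f a)) = (blocks a).flatten)
    (hisBlock : ∀ a, ∀ b ∈ blocks a, P.IsBlock b)
    (himage : ∀ a, eb' (f' a) = (blocks a).flatMap P.image) :
    PolyTime ea eb' f' := by
  obtain ⟨⟨tm, ei, eo⟩, time, outputs⟩ := hf
  let _ := Fintype.ofFinite Γ₁
  let _ := Fintype.ofFinite Q
  let _ := tm.ΛFin
  let B := ∑ l, pushCount (tm.m l)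
  have hB : ∀ l, pushCount (tm.m l) ≤ B := fun l =>
    Finset.single_le_sum (f := fun l => pushCount (tm.m l)) (fun _ _ => Nat.zero_le _)
      (Finset.mem_univ l)
  let c := 6 * P.passes.length + 6
  refine ⟨⟨⟨P.machine tm eo, ei, Equiv.refl _⟩,
    time + (Polynomial.X + Polynomial.C B * time) * Polynomial.C c + 3,
    fun a => Classical.choice ?_⟩⟩
  have hw' : P.annotate P.init ((List.map eo.invFun (eb (f a))).map eo) = (blocks a).flatten := by
    simpa using hblocks a
  obtain ⟨hall⟩ := PostProc.outputsInTime_machine (outputs a) (blocks a) hw' (hisBlock a)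
  have hlen := length_output_le hB (outputs a)
  simp only [List.length_map] at hlen hall
  have hmap : List.map (Equiv.refl Γ₂).invFun (eb' (f' a)) = (blocks a).flatMap P.image :=
    (List.map_id _).trans (himage a)
  refine ⟨⟨⟨hall.steps, hall.evals_in_steps.trans ?_⟩, hall.steps_le_m.trans ?_⟩⟩
  · exact congrArg (fun s => some (haltList (P.machine tm eo) s)) hmap.symm
  · simp only [Polynomial.eval_add, Polynomial.eval_mul, Polynomial.eval_X, Polynomial.eval_C,
      Polynomial.eval_ofNat]
    gcongr

end PostProcessing

/-! ### Reductions given by templates -/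

/-- The first constant of a fact over the binary relation symbol. -/
def constA (f : Fact sigZero) : Const := f.2 (0 : Fin 2)

/-- The second constant of a fact over the binary relation symbol. -/
def constB (f : Fact sigZero) : Const := f.2 (1 : Fin 2)

/-- A self-delimiting code for the constant `c` if `u` is true, and for nothing otherwise: each bit
is preceded by `true`, and the end is marked by `false`. -/
def optionalCode (u : Bool) (c : Const) : List Bool :=
  (if u then c.flatMap fun x => [true, x] else []) ++ [false, u]

/-- A template for an attribute value that is computed from the constants of a binary fact: the
value consists of a tag and, as prescribed by two flags, of the constants of the fact. -/
structure AttrTemplate where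
  tag : ℕ
  useA : Bool
  useB : Bool
  deriving DecidableEq

/-- The attribute value given by a template and the constants of a binary fact. -/
def AttrTemplate.value (ℓ : AttrTemplate) (a b : Const) : Const :=
  optionalCode ℓ.useA a ++ (optionalCode ℓ.useB b ++ List.replicate ℓ.tag true)

lemma flatMap_marked_append_inj {a a' : Const} {u u' : Bool} {r r' : List Bool}
    (h : a.flatMap (fun x => [true, x]) ++ ([false, u] ++ r) =
      a'.flatMap (fun x => [true, x]) ++ ([false, u'] ++ r')) : a = a' ∧ u = u' ∧ r = r' := by
  induction a generalizing a' with
  | nil =>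
    cases a' with
    | nil => simpa using h
    | cons x a' => simp at h
  | cons y a ih =>
    cases a' with
    | nil => simp at h
    | cons x a' =>
      simp only [List.flatMap_cons, List.cons_append, List.nil_append, List.cons.injEq,
        true_and] at h
      obtain ⟨rfl, h⟩ := h
      obtain ⟨rfl, hu, hr⟩ := ih h
      exact ⟨rfl, hu, hr⟩

lemma optionalCode_append_inj {c c' : Const} {u u' : Bool} {r r' : List Bool} :
    optionalCode u c ++ r = optionalCode u' c' ++ r' ↔
      u = u' ∧ (u = true → c = c') ∧ r = r' := by
  constructor
  · intro h
    have hcode : ∀ (u : Bool) (c : Const), (if u then c.flatMap fun x => [true, x] else []) =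
        (if u then c else []).flatMap fun x => [true, x] := by
      intro u c; cases u <;> rfl
    simp only [optionalCode, hcode, List.append_assoc] at h
    obtain ⟨hc, rfl, hr⟩ := flatMap_marked_append_inj h
    exact ⟨rfl, fun hu => by simpa [hu] using hc, hr⟩
  · rintro ⟨rfl, hc, rfl⟩
    cases u
    · rfl
    · rw [hc rfl]

lemma AttrTemplate.value_inj {ℓ ℓ' : AttrTemplate} {a b a' b' : Const} :
    ℓ.value a b = ℓ'.value a' b' ↔
      ℓ = ℓ' ∧ (ℓ.useA = true → a = a') ∧ (ℓ.useB = true → b = b') := by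
  obtain ⟨n, u, v⟩ := ℓ
  obtain ⟨n', u', v'⟩ := ℓ'
  have htag : List.replicate n true = List.replicate n' true ↔ n = n' :=
    ⟨fun h => by simpa using congrArg List.length h, fun h => by rw [h]⟩
  simp only [value, optionalCode_append_inj, htag, mk.injEq]
  tauto

/-- A template for the facts over a relation symbol of arity `k`. -/
abbrev Template (k : ℕ) : Type := Fin k → AttrTemplate

/-- The tuple obtained from a binary fact by means of a template. -/
def Template.tuple {k : ℕ} (τ : Template k) (f : Fact sigZero) (j : Fin k) : Const :=
  (τ j).value (constA f) (constB f)

/-- The fact obtained from a binary fact by means of a template. -/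
def Template.fact {σ : Signature} {R : Fin σ.num} (τ : Template (σ.arity R)) (f : Fact sigZero) :
    Fact σ :=
  ⟨R, τ.tuple f⟩

lemma Template.fact_inj {σ : Signature} {R : Fin σ.num} {τ τ' : Template (σ.arity R)}
    {f g : Fact sigZero} : τ.fact f = τ'.fact g ↔ τ.tuple f = τ'.tuple g := by
  simp only [Template.fact, Sigma.mk.injEq, heq_eq_eq, true_and]

lemma encodeFact_sigZero (f : Fact sigZero) :
    encodeFact f = encodeConst (constA f) ++ (encodeConst (constB f) ++ [Token.endFact]) := by
  obtain ⟨R, t⟩ := f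
  obtain rfl : R = 0 := Subsingleton.elim (α := Fin 1) R 0
  simp [encodeFact, constA, constB]

lemma endInstance_notMem_encodeFact {σ : Signature} (f : Fact σ) :
    Token.endInstance ∉ encodeFact f := by
  simp [encodeFact, encodeConst]

namespace PostProc

variable {Q Γ₁ Γ₂ : Type*} (P : PostProc Q Γ₁ Γ₂)

lemma annotate_append (q : Q) (u v : List Γ₁) :
    P.annotate q (u ++ v) = P.annotate q u ++ P.annotate (u.foldl P.next q) v := by
  induction u generalizing q with
  | nil => rfl
  | cons x u ih => exact congrArg _ (ih _)

lemma map_snd_annotate (q : Q) (w : List Γ₁) : (P.annotate q w).map Prod.snd = w := by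
  induction w generalizing q with
  | nil => rfl
  | cons x w ih => exact congrArg _ (ih _)

end PostProc

/-! ### Duplicating the facts -/

/-- The transformation that repeats the part up to the first end marker of the instance. The state
records whether the next letter is the first one, and whether the marker has been read. -/
def duplicator : PostProc (Bool × Bool) Token Token where
  init := (true, false)
  next q t := (false, q.2 || t = .endInstance)
  isStart x := x.1.1
  passes := [fun x => if x.1.2 then [] else [x.2], fun x => [x.2]]

lemma isBlock_annotate_duplicator {w : List Token} (hw : w ≠ []) :
    duplicator.IsBlock (duplicator.annotate duplicator.init w) := by
  have hrest : ∀ (w : List Token) (b : Bool), ∀ x ∈ duplicator.annotate (false, b) w,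
      duplicator.isStart x = false := by
    intro w
    induction w with
    | nil => simp [PostProc.annotate]
    | cons t w ih =>
      rintro b x (_ | ⟨_, hx⟩)
      · rfl
      · exact ih _ x hx
  obtain ⟨t, w, rfl⟩ := List.exists_cons_of_ne_nil hw
  exact ⟨_, _, rfl, rfl, hrest _ _⟩

lemma flatMap_unmarked_annotate_duplicator (b : Bool) {u : List Token} (v : List Token)
    (hu : Token.endInstance ∉ u) :
    ((duplicator.annotate (b, false) (u ++ Token.endInstance :: v)).flatMap
      fun x => if x.1.2 then [] else [x.2]) = u ++ [Token.endInstance] := by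
  have hmarked : ∀ v : List Token, ((duplicator.annotate (false, true) v).flatMap
      fun x => if x.1.2 then [] else [x.2]) = [] := by
    intro v
    induction v with
    | nil => rfl
    | cons _ _ ih => exact ih
  induction u generalizing b with
  | nil => exact congrArg (Token.endInstance :: ·) (hmarked v)
  | cons t u ih =>
    obtain ⟨ht, hu⟩ := not_or.1 (mt List.mem_cons.2 hu)
    have hnext : duplicator.next (b, false) t = (false, false) := by
      simp [duplicator, Ne.symm ht]
    rw [List.cons_append, PostProc.annotate, hnext, List.flatMap_cons, ih _ hu]
    rfl

/-- An encoding of inputs in which the list of facts occurs twice. -/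
def encodeDoubled {S : Schema} (D : Input S) : List Token :=
  D.facts.flatMap encodeFact ++ [Token.endInstance] ++ encodeInput D

lemma PolyTime.doubled {α Γ₀ : Type} {ea : α → List Γ₀} {S : Schema} {f : α → Input S}
    (hf : PolyTime ea encodeInput f) : PolyTime ea encodeDoubled f := by
  refine hf.postProc duplicator
    (fun x => [duplicator.annotate duplicator.init (encodeInput (f x))]) (fun a => by simp) ?_ ?_
  · simp only [List.mem_singleton, forall_eq]
    exact fun a => isBlock_annotate_duplicator (by simp [encodeInput])
  · intro a
    have hfacts := flatMap_unmarked_annotate_duplicator true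
      ((f a).pairs.flatMap fun p => encodeFact p.1 ++ encodeFact p.2)
      (u := (f a).facts.flatMap encodeFact) (by simp [endInstance_notMem_encodeFact])
    have hall := duplicator.map_snd_annotate duplicator.init (encodeInput (f a))
    rw [List.map_eq_flatMap] at hall
    rw [← List.singleton_append, ← List.append_assoc] at hfacts
    simp only [List.flatMap_singleton, encodeDoubled]
    exact (congrArg₂ (· ++ ·) hfacts.symm (hall.symm.trans (List.append_nil _).symm))

/-! ### Filling in the templates -/

/-- A position in a doubled encoding: whether a block starts there, the part of the encoding (the
facts, their copy, or the pairs), whether the position is in the second fact of a pair, and the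
number of constants of the fact that precede it. -/
structure Pos where
  start : Bool
  part : Fin 3
  second : Bool
  idx : Fin 3
  deriving DecidableEq, Fintype

/-- The position at the start of a block. -/
abbrev Pos.blockStart (s : Fin 3) : Pos := ⟨true, s, false, 0⟩

/-- The position after a letter. A block is a fact in the first two parts, a pair of facts in the
third part, or the marker between two parts. -/
def Pos.next (q : Pos) : Token → Pos
  | .endConst => ⟨false, q.part, q.second, q.idx + 1⟩
  | .endFact => if q.part = 2 ∧ q.second = false then ⟨false, 2, true, 0⟩ else .blockStart q.part
  | .endInstance => .blockStart (q.part + 1)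
  | _ => ⟨false, q.part, q.second, q.idx⟩

/-- A rule for rewriting the letters of a binary fact, given the number of constants of the fact
that precede the letter. -/
abbrev Rule : Type := Fin 3 → Token → List Token

/-- Apply a rule to the letters of the part `s` that belong to the first or second fact. -/
def Rule.pass (s : Fin 3) (second : Bool) (p : Rule) (x : Pos × Token) : List Token :=
  if x.1.part = s ∧ x.1.second = second then p x.1.idx x.2 else []

/-- The result of applying a rule to all letters of a fact. -/
def Rule.rewrite (p : Rule) (f : Fact sigZero) : List Token :=
  (encodeConst (constA f)).flatMap (p 0) ++ ((encodeConst (constB f)).flatMap (p 1) ++ p 2 .endFact)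

/-- The rule that writes the relation symbol with index `r`. -/
def relRule (r : ℕ) : Rule
  | 2, .endFact => List.replicate r .rel
  | _, _ => []

/-- The rule that writes an attribute value. -/
def attrRule (ℓ : AttrTemplate) : Rule
  | 0, .bit x => if ℓ.useA then [.bit true, .bit x] else []
  | 0, .endConst => [.bit false, .bit ℓ.useA]
  | 1, .bit x => if ℓ.useB then [.bit true, .bit x] else []
  | 1, .endConst => [.bit false, .bit ℓ.useB]
  | 2, .endFact => List.replicate ℓ.tag (.bit true) ++ [.endConst]
  | _, _ => []

/-- The rule that writes the end marker of a fact. -/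
def endRule : Rule
  | 2, .endFact => [.endFact]
  | _, _ => []

/-- The rule that copies the end marker of the instance. -/
def markerRule : Rule
  | 0, .endInstance => [.endInstance]
  | _, _ => []

/-- The rules that write the fact given by a template. -/
def Template.rules {σ : Signature} {R : Fin σ.num} (τ : Template (σ.arity R)) : List Rule :=
  relRule R :: ((List.ofFn fun j => attrRule (τ j)) ++ [endRule])

lemma flatMap_const_nil {α β : Type*} (l : List α) : (l.flatMap fun _ => ([] : List β)) = [] :=
  List.flatMap_eq_nil_iff.2 fun _ _ => rfl

lemma rewrite_relRule (r : ℕ) (f : Fact sigZero) :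
    (relRule r).rewrite f = List.replicate r .rel := by
  simp [Rule.rewrite, relRule, encodeConst, List.flatMap_map, flatMap_const_nil]

lemma rewrite_endRule (f : Fact sigZero) : endRule.rewrite f = [.endFact] := by
  simp [Rule.rewrite, endRule, encodeConst, List.flatMap_map, flatMap_const_nil]

lemma rewrite_markerRule (f : Fact sigZero) : markerRule.rewrite f = [] := by
  simp [Rule.rewrite, markerRule, encodeConst, List.flatMap_map, flatMap_const_nil]

lemma rewrite_attrRule (ℓ : AttrTemplate) (f : Fact sigZero) :
    (attrRule ℓ).rewrite f = encodeConst (ℓ.value (constA f) (constB f)) := by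
  have hbits : ∀ (u : Bool) (a : Const),
      (a.flatMap fun x => if u = true then [Token.bit true, Token.bit x] else []) =
        (if u = true then a.flatMap fun x => [true, x] else []).map Token.bit := by
    intro u a; cases u <;> simp [List.map_flatMap]
  simp [Rule.rewrite, attrRule, encodeConst, AttrTemplate.value, optionalCode, List.flatMap_map,
    hbits]

lemma Template.flatMap_rewrite_rules {σ : Signature} {R : Fin σ.num} (τ : Template (σ.arity R))
    (f : Fact sigZero) : (τ.rules.flatMap fun p => p.rewrite f) = encodeFact (τ.fact f) := by
  have hattrs : ((List.ofFn fun j => attrRule (τ j)).flatMap fun p => p.rewrite f) =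
      (List.ofFn (τ.tuple f)).flatMap encodeConst := by
    rw [List.flatMap_def, List.flatMap_def, List.map_ofFn, List.map_ofFn]
    congr 2
    funext j
    exact rewrite_attrRule _ _
  simp [rules, hattrs, rewrite_relRule, rewrite_endRule, encodeFact, fact]

section Filler

variable {σ : Signature} {R : Fin σ.num}

/-- The passes that write the fact given by a template. -/
def Template.passes (τ : Template (σ.arity R)) (s : Fin 3) (second : Bool) :
    List (Pos × Token → List Token) :=
  τ.rules.map (Rule.pass s second)

/-- The transformation that fills in templates: `T₁` for the facts, `T₂` for the priorities between
facts that arise from the same fact, and `T₃` for those that arise from a priority. -/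
def filler (T₁ : List (Template (σ.arity R)))
    (T₂ T₃ : List (Template (σ.arity R) × Template (σ.arity R))) : PostProc Pos Token Token where
  init := .blockStart 0
  next := Pos.next
  isStart x := x.1.start
  passes := T₁.flatMap (fun τ => τ.passes 0 false) ++ Rule.pass 0 false markerRule ::
    (T₂.flatMap (fun t => t.1.passes 1 false ++ t.2.passes 1 false) ++
      T₃.flatMap fun t => t.1.passes 2 false ++ t.2.passes 2 true)

variable {T₁ : List (Template (σ.arity R))}
  {T₂ T₃ : List (Template (σ.arity R) × Template (σ.arity R))}

lemma foldl_next_encodeConst (q : Pos) (c : Const) :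
    (encodeConst c).foldl Pos.next q = ⟨false, q.part, q.second, q.idx + 1⟩ := by
  induction c generalizing q with
  | nil => rfl
  | cons _ _ ih => exact ih _

lemma foldl_next_encodeFact (b second : Bool) (s : Fin 3) (f : Fact sigZero) :
    (encodeFact f).foldl Pos.next ⟨b, s, second, 0⟩ =
      if s = 2 ∧ second = false then ⟨false, 2, true, 0⟩ else .blockStart s := by
  rw [encodeFact_sigZero, List.foldl_append, List.foldl_append, foldl_next_encodeConst,
    foldl_next_encodeConst]
  rfl

lemma flatMap_pass_annotate_encodeConst (q : Pos) (c : Const) (s : Fin 3) (second : Bool)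
    (p : Rule) :
    ((filler T₁ T₂ T₃).annotate q (encodeConst c)).flatMap (p.pass s second) =
      if q.part = s ∧ q.second = second then (encodeConst c).flatMap (p q.idx) else [] := by
  induction c generalizing q with
  | nil => simp [encodeConst, PostProc.annotate, Rule.pass]
  | cons x c ih =>
    refine (congrArg (p.pass s second (q, .bit x) ++ ·) (ih _)).trans ?_
    by_cases h : q.part = s ∧ q.second = second
    · simp [Rule.pass, h, Pos.next, filler, encodeConst]
    · simp only [Rule.pass, if_neg h]
      exact if_neg h

lemma annotate_filler_encodeFact (q : Pos) (f : Fact sigZero) :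
    (filler T₁ T₂ T₃).annotate q (encodeFact f) =
      (filler T₁ T₂ T₃).annotate q (encodeConst (constA f)) ++
        ((filler T₁ T₂ T₃).annotate ⟨false, q.part, q.second, q.idx + 1⟩
          (encodeConst (constB f)) ++
          [(⟨false, q.part, q.second, q.idx + 1 + 1⟩, .endFact)]) := by
  rw [encodeFact_sigZero, PostProc.annotate_append, PostProc.annotate_append,
    show (filler T₁ T₂ T₃).next = Pos.next from rfl, foldl_next_encodeConst,
    foldl_next_encodeConst]
  rfl

lemma flatMap_pass_annotate_encodeFact (b second second' : Bool) (s s' : Fin 3)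
    (f : Fact sigZero) (p : Rule) :
    ((filler T₁ T₂ T₃).annotate ⟨b, s, second, 0⟩ (encodeFact f)).flatMap (p.pass s' second') =
      if s = s' ∧ second = second' then p.rewrite f else [] := by
  rw [annotate_filler_encodeFact, List.flatMap_append, List.flatMap_append,
    flatMap_pass_annotate_encodeConst, flatMap_pass_annotate_encodeConst]
  split_ifs with h
  · obtain ⟨rfl, rfl⟩ := h
    simp [Rule.pass, Rule.rewrite]
  · simp [Rule.pass, h]

variable (T₁ T₂ T₃) in
/-- The block of a fact. -/
def factBlock (s : Fin 3) (f : Fact sigZero) : List (Pos × Token) :=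
  (filler T₁ T₂ T₃).annotate (.blockStart s) (encodeFact f)

variable (T₁ T₂ T₃) in
/-- The block of a pair of facts. -/
def pairBlock (p : Fact sigZero × Fact sigZero) : List (Pos × Token) :=
  (filler T₁ T₂ T₃).annotate (.blockStart 2) (encodeFact p.1 ++ encodeFact p.2)

lemma pairBlock_eq (p : Fact sigZero × Fact sigZero) :
    pairBlock T₁ T₂ T₃ p = factBlock T₁ T₂ T₃ 2 p.1 ++
      (filler T₁ T₂ T₃).annotate ⟨false, 2, true, 0⟩ (encodeFact p.2) := by
  rw [pairBlock, PostProc.annotate_append, show (filler T₁ T₂ T₃).next = Pos.next from rfl,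
    foldl_next_encodeFact]
  rfl

variable (T₁ T₂ T₃) in
/-- The blocks of a doubled encoding. -/
def fillerBlocks (D : Input schemaZero) : List (List (Pos × Token)) :=
  D.facts.map (factBlock T₁ T₂ T₃ 0) ++ ([(.blockStart 0, .endInstance)] ::
    (D.facts.map (factBlock T₁ T₂ T₃ 1) ++ ([(.blockStart 1, .endInstance)] ::
      D.pairs.map (pairBlock T₁ T₂ T₃))))

lemma annotate_filler_facts {s : Fin 3} (hs : s ≠ 2) (l : List (Fact sigZero)) (w : List Token) :
    (filler T₁ T₂ T₃).annotate (.blockStart s) (l.flatMap encodeFact ++ w) =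
      (l.map (factBlock T₁ T₂ T₃ s)).flatten ++
        (filler T₁ T₂ T₃).annotate (.blockStart s) w := by
  induction l with
  | nil => rfl
  | cons f l ih =>
    rw [List.flatMap_cons, List.append_assoc, PostProc.annotate_append,
      show (filler T₁ T₂ T₃).next = Pos.next from rfl, foldl_next_encodeFact,
      if_neg fun h => hs h.1, ih, List.map_cons, List.flatten_cons, List.append_assoc]
    rfl

lemma annotate_filler_pairs (l : List (Fact sigZero × Fact sigZero)) :
    (filler T₁ T₂ T₃).annotate (.blockStart 2)
        (l.flatMap fun p => encodeFact p.1 ++ encodeFact p.2) =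
      (l.map (pairBlock T₁ T₂ T₃)).flatten := by
  induction l with
  | nil => rfl
  | cons p l ih =>
    rw [List.flatMap_cons, PostProc.annotate_append, List.foldl_append,
      show (filler T₁ T₂ T₃).next = Pos.next from rfl, foldl_next_encodeFact,
      if_pos ⟨rfl, rfl⟩, foldl_next_encodeFact, if_neg (by decide), ih]
    rfl

lemma annotate_filler_encodeDoubled (D : Input schemaZero) :
    (filler T₁ T₂ T₃).annotate (.blockStart 0) (encodeDoubled D) =
      (fillerBlocks T₁ T₂ T₃ D).flatten := by
  simp only [encodeDoubled, encodeInput, List.append_assoc, List.singleton_append]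
  rw [annotate_filler_facts (by decide), PostProc.annotate,
    show (filler T₁ T₂ T₃).next (.blockStart 0) .endInstance = .blockStart 1 from rfl,
    annotate_filler_facts (by decide), PostProc.annotate,
    show (filler T₁ T₂ T₃).next (.blockStart 1) .endInstance = .blockStart 2 from rfl,
    annotate_filler_pairs]
  simp [fillerBlocks]

lemma start_of_mem_annotate_encodeConst {q : Pos} (hq : q.start = false) (c : Const) :
    ∀ x ∈ (filler T₁ T₂ T₃).annotate q (encodeConst c), x.1.start = false := by
  induction c generalizing q with
  | nil => rintro x (_ | ⟨_, ⟨⟩⟩); exact hq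
  | cons b c ih =>
    rintro x (_ | ⟨_, hx⟩)
    · exact hq
    · exact ih rfl x hx

lemma start_of_mem_annotate_encodeFact {q : Pos} (hq : q.start = false) (f : Fact sigZero) :
    ∀ x ∈ (filler T₁ T₂ T₃).annotate q (encodeFact f), x.1.start = false := by
  rw [annotate_filler_encodeFact]
  simp only [List.mem_append, List.mem_singleton]
  rintro x (hx | hx | rfl)
  · exact start_of_mem_annotate_encodeConst hq _ x hx
  · exact start_of_mem_annotate_encodeConst rfl _ x hx
  · rfl

-- Whether a block starts at a position has no influence on the positions that follow it.
lemma isBlock_annotate_blockStart {s : Fin 3} {w : List Token} (hw : w ≠ [])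
    (h : ∀ x ∈ (filler T₁ T₂ T₃).annotate ⟨false, s, false, 0⟩ w, x.1.start = false) :
    (filler T₁ T₂ T₃).IsBlock ((filler T₁ T₂ T₃).annotate (.blockStart s) w) := by
  obtain ⟨t, w, rfl⟩ := List.exists_cons_of_ne_nil hw
  refine ⟨_, _, rfl, rfl, fun x hx => h x (List.mem_cons_of_mem _ ?_)⟩
  cases t <;> exact hx

lemma isBlock_of_mem_fillerBlocks {D : Input schemaZero} :
    ∀ b ∈ fillerBlocks T₁ T₂ T₃ D, (filler T₁ T₂ T₃).IsBlock b := by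
  have hfact : ∀ (s : Fin 3) (f : Fact sigZero),
      (filler T₁ T₂ T₃).IsBlock (factBlock T₁ T₂ T₃ s f) := fun s f =>
    isBlock_annotate_blockStart (by simp [encodeFact]) (start_of_mem_annotate_encodeFact rfl f)
  have hpair : ∀ p, (filler T₁ T₂ T₃).IsBlock (pairBlock T₁ T₂ T₃ p) := by
    refine fun p => isBlock_annotate_blockStart (by simp [encodeFact]) fun x hx => ?_
    rw [PostProc.annotate_append, show (filler T₁ T₂ T₃).next = Pos.next from rfl,
      foldl_next_encodeFact] at hx
    rcases List.mem_append.1 hx with hx | hx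
    · exact start_of_mem_annotate_encodeFact rfl _ x hx
    · exact start_of_mem_annotate_encodeFact rfl _ x hx
  have hmarker : ∀ s : Fin 3, (filler T₁ T₂ T₃).IsBlock [(.blockStart s, .endInstance)] :=
    fun s => ⟨_, [], rfl, rfl, by simp⟩
  intro b hb
  simp only [fillerBlocks, List.mem_append, List.mem_cons, List.mem_map] at hb
  rcases hb with ⟨f, -, rfl⟩ | rfl | ⟨f, -, rfl⟩ | rfl | ⟨p, -, rfl⟩
  exacts [hfact 0 f, hmarker 0, hfact 1 f, hmarker 1, hpair p]

lemma Template.flatMap_passes {τ : Template (σ.arity R)} {s : Fin 3} {second : Bool}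
    {b : List (Pos × Token)} {f : Fact sigZero}
    (hb : ∀ p : Rule, b.flatMap (p.pass s second) = p.rewrite f) :
    ((τ.passes s second).flatMap fun h => b.flatMap h) = encodeFact (τ.fact f) := by
  simp only [passes, List.flatMap_map, hb, flatMap_rewrite_rules]

lemma Template.flatMap_passes_eq_nil {τ : Template (σ.arity R)} {s : Fin 3} {second : Bool}
    {b : List (Pos × Token)} (hb : ∀ p ∈ τ.rules, b.flatMap (p.pass s second) = []) :
    ((τ.passes s second).flatMap fun h => b.flatMap h) = [] := by
  rw [passes, List.flatMap_map]
  exact List.flatMap_eq_nil_iff.2 hb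

lemma image_filler_factBlock_zero (f : Fact sigZero) :
    (filler T₁ T₂ T₃).image (factBlock T₁ T₂ T₃ 0 f) =
      T₁.flatMap fun τ => encodeFact (τ.fact f) := by
  have hpass := fun s second p =>
    flatMap_pass_annotate_encodeFact (T₁ := T₁) (T₂ := T₂) (T₃ := T₃) true false second 0 s f p
  have hfill : ∀ τ : Template (σ.arity R), ((τ.passes 0 false).flatMap fun h =>
      (factBlock T₁ T₂ T₃ 0 f).flatMap h) = encodeFact (τ.fact f) := fun τ =>
    Template.flatMap_passes fun p => by rw [factBlock, hpass, if_pos ⟨rfl, rfl⟩]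
  have hskip : ∀ (s : Fin 3) (second : Bool) (τ : Template (σ.arity R)), s ≠ 0 →
      ((τ.passes s second).flatMap fun h => (factBlock T₁ T₂ T₃ 0 f).flatMap h) = [] :=
    fun s second τ hs => Template.flatMap_passes_eq_nil fun p _ => by
      rw [factBlock, hpass, if_neg fun h => hs h.1.symm]
  have hmarker : (factBlock T₁ T₂ T₃ 0 f).flatMap (Rule.pass 0 false markerRule) = [] := by
    rw [factBlock, hpass, rewrite_markerRule, ite_self]
  simp only [PostProc.image, filler, List.flatMap_append, List.flatMap_cons, List.flatMap_assoc,
    hfill, hskip 1 _ _ (by decide), hskip 2 _ _ (by decide), hmarker, flatMap_const_nil,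
    List.append_nil]

lemma image_filler_factBlock_one (f : Fact sigZero) :
    (filler T₁ T₂ T₃).image (factBlock T₁ T₂ T₃ 1 f) =
      T₂.flatMap fun t => encodeFact (t.1.fact f) ++ encodeFact (t.2.fact f) := by
  have hpass := fun s second p =>
    flatMap_pass_annotate_encodeFact (T₁ := T₁) (T₂ := T₂) (T₃ := T₃) true false second 1 s f p
  have hfill : ∀ τ : Template (σ.arity R), ((τ.passes 1 false).flatMap fun h =>
      (factBlock T₁ T₂ T₃ 1 f).flatMap h) = encodeFact (τ.fact f) := fun τ =>
    Template.flatMap_passes fun p => by rw [factBlock, hpass, if_pos ⟨rfl, rfl⟩]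
  have hskip : ∀ (s : Fin 3) (second : Bool) (τ : Template (σ.arity R)), s ≠ 1 →
      ((τ.passes s second).flatMap fun h => (factBlock T₁ T₂ T₃ 1 f).flatMap h) = [] :=
    fun s second τ hs => Template.flatMap_passes_eq_nil fun p _ => by
      rw [factBlock, hpass, if_neg fun h => hs h.1.symm]
  have hmarker : (factBlock T₁ T₂ T₃ 1 f).flatMap (Rule.pass 0 false markerRule) = [] := by
    rw [factBlock, hpass, rewrite_markerRule, ite_self]
  simp only [PostProc.image, filler, List.flatMap_append, List.flatMap_cons, List.flatMap_assoc,
    hfill, hskip 0 _ _ (by decide), hskip 2 _ _ (by decide), hmarker, flatMap_const_nil,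
    List.append_nil, List.nil_append]

lemma image_filler_pairBlock (p : Fact sigZero × Fact sigZero) :
    (filler T₁ T₂ T₃).image (pairBlock T₁ T₂ T₃ p) =
      T₃.flatMap fun t => encodeFact (t.1.fact p.1) ++ encodeFact (t.2.fact p.2) := by
  have hpass : ∀ (s : Fin 3) (second : Bool) (r : Rule),
      (pairBlock T₁ T₂ T₃ p).flatMap (r.pass s second) =
        if 2 = s then r.rewrite (if second then p.2 else p.1) else [] := by
    intro s second r
    rw [pairBlock_eq, List.flatMap_append, factBlock, flatMap_pass_annotate_encodeFact,
      flatMap_pass_annotate_encodeFact]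
    cases second <;> simp
  have hfill : ∀ (second : Bool) (τ : Template (σ.arity R)),
      ((τ.passes 2 second).flatMap fun h => (pairBlock T₁ T₂ T₃ p).flatMap h) =
        encodeFact (τ.fact (if second then p.2 else p.1)) := fun second τ =>
    Template.flatMap_passes fun r => by rw [hpass, if_pos rfl]
  have hskip : ∀ (s : Fin 3) (second : Bool) (τ : Template (σ.arity R)), s ≠ 2 →
      ((τ.passes s second).flatMap fun h => (pairBlock T₁ T₂ T₃ p).flatMap h) = [] :=
    fun s second τ hs => Template.flatMap_passes_eq_nil fun r _ => by
      rw [hpass, if_neg hs.symm]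
  have hmarker : (pairBlock T₁ T₂ T₃ p).flatMap (Rule.pass 0 false markerRule) = [] := by
    rw [hpass, if_neg (by decide)]
  simp only [PostProc.image, filler, List.flatMap_append, List.flatMap_cons, List.flatMap_assoc,
    hfill, hskip 0 _ _ (by decide), hskip 1 _ _ (by decide), hmarker, flatMap_const_nil,
    List.append_nil, List.nil_append, if_true, Bool.false_eq_true, if_false]

lemma image_filler_marker (s : Fin 3) :
    (filler T₁ T₂ T₃).image [(.blockStart s, .endInstance)] =
      if s = 0 then [Token.endInstance] else [] := by
  have hskip : ∀ (s' : Fin 3) (second : Bool) (τ : Template (σ.arity R)),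
      ((τ.passes s' second).flatMap fun h => h (Pos.blockStart s, Token.endInstance)) = [] := by
    intro s' second τ
    rw [← (Template.flatMap_passes_eq_nil fun p hp => ?_ :
      ((τ.passes s' second).flatMap fun h => [(Pos.blockStart s, Token.endInstance)].flatMap h) =
        [])]
    · simp only [List.flatMap_cons, List.flatMap_nil, List.append_nil]
    simp only [Template.rules, List.mem_cons, List.mem_append, List.mem_ofFn, List.not_mem_nil,
      or_false] at hp
    rcases hp with rfl | ⟨j, rfl⟩ | rfl <;> simp [Rule.pass, relRule, attrRule, endRule]
  simp only [PostProc.image, filler, List.flatMap_append, List.flatMap_cons, List.flatMap_assoc,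
    List.flatMap_nil, List.append_nil]
  simp only [hskip, flatMap_const_nil, List.append_nil, List.nil_append]
  simp [Rule.pass, markerRule]

end Filler

theorem PolyTime.template {α Γ₀ : Type} {ea : α → List Γ₀} {f : α → Input schemaZero}
    (hf : PolyTime ea encodeInput f) {S : Schema} {R : Fin S.sig.num}
    (T₁ : List (Template (S.sig.arity R)))
    (T₂ T₃ : List (Template (S.sig.arity R) × Template (S.sig.arity R))) (F : α → Input S)
    (hfacts : ∀ x, (F x).facts = (f x).facts.flatMap fun φ => T₁.map fun τ => τ.fact φ)
    (hpairs : ∀ x, (F x).pairs =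
      ((f x).facts.flatMap fun φ => T₂.map fun t => (t.1.fact φ, t.2.fact φ)) ++
        (f x).pairs.flatMap fun p => T₃.map fun t => (t.1.fact p.1, t.2.fact p.2)) :
    PolyTime ea encodeInput F := by
  refine hf.doubled.postProc (filler T₁ T₂ T₃) (fun x => fillerBlocks T₁ T₂ T₃ (f x))
    (fun x => annotate_filler_encodeDoubled (f x)) (fun x => isBlock_of_mem_fillerBlocks) ?_
  intro x
  simp only [encodeInput, hfacts, hpairs, fillerBlocks, List.flatMap_append, List.flatMap_cons,
    List.flatMap_map, image_filler_factBlock_zero, image_filler_factBlock_one,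
    image_filler_pairBlock, image_filler_marker, List.flatMap_assoc, List.append_assoc]
  rfl

/-! ### Optimal sets with respect to a conflict relation -/

section Optimal

variable {α β : Type*}

/-- A set without conflicts. It may be empty or not maximal, and `conf` need not be symmetric. -/
def Indep (conf : α → α → Prop) (J : Finset α) : Prop :=
  ∀ f ∈ J, ∀ g ∈ J, ¬ conf f g

/-- The set `J` is a global improvement of `J'`, regardless of consistency. -/
def Improves (prec : α → α → Prop) (J J' : Finset α) : Prop :=
  J ≠ J' ∧ ∀ f' ∈ J', f' ∉ J → ∃ f ∈ J, f ∉ J' ∧ prec f f'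

/-- A globally-optimal repair of `I`, for a conflict relation and a priority relation on a type:
an independent subset of `I` that no independent subset of `I` improves. -/
def Optimal (I : Finset α) (conf prec : α → α → Prop) (J : Finset α) : Prop :=
  J ⊆ I ∧ Indep conf J ∧ ∀ K ⊆ I, Indep conf K → ¬ Improves prec K J

variable [DecidableEq β] {I J : Finset α} {conf prec : α → α → Prop} {conf' prec' : β → β → Prop}
  {ψ : α → β}

lemma indep_image_iff (hconf : ∀ x ∈ J, ∀ y ∈ J, conf' (ψ x) (ψ y) ↔ conf x y) :
    Indep conf' (J.image ψ) ↔ Indep conf J := by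
  simp only [Indep, Finset.forall_mem_image]
  exact forall₂_congr fun x hx => forall₂_congr fun y hy => not_congr (hconf x hx y hy)

lemma improves_image_iff (hψ : ψ.Injective) {K : Finset α}
    (hprec : ∀ x ∈ K, ∀ y ∈ J, prec' (ψ x) (ψ y) ↔ prec x y) :
    Improves prec' (K.image ψ) (J.image ψ) ↔ Improves prec K J := by
  refine and_congr (Finset.image_injective hψ).ne_iff ?_
  simp only [Finset.forall_mem_image, Finset.exists_mem_image, hψ.mem_finset_image]
  refine forall₂_congr fun x hx => imp_congr_right fun _ => exists_congr fun y => ?_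
  exact and_congr_right fun hy => and_congr_right fun _ => hprec y hy x hx

lemma optimal_image_iff (hψ : ψ.Injective)
    (hconf : ∀ x ∈ I, ∀ y ∈ I, conf' (ψ x) (ψ y) ↔ conf x y)
    (hprec : ∀ x ∈ I, ∀ y ∈ I, prec' (ψ x) (ψ y) ↔ prec x y) (hJ : J ⊆ I) :
    Optimal (I.image ψ) conf' prec' (J.image ψ) ↔ Optimal I conf prec J := by
  have hindep : ∀ K ⊆ I, Indep conf' (K.image ψ) ↔ Indep conf K := fun K hK =>
    indep_image_iff fun x hx y hy => hconf x (hK hx) y (hK hy)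
  have himproves : ∀ K ⊆ I, Improves prec' (K.image ψ) (J.image ψ) ↔ Improves prec K J :=
    fun K hK => improves_image_iff hψ fun x hx y hy => hprec x (hK hx) y (hJ hy)
  refine and_congr (by simp [hJ, Finset.image_subset_image hJ]) (and_congr (hindep J hJ) ?_)
  constructor
  · intro h K hK hKi hKJ
    exact h _ (Finset.image_subset_image hK) ((hindep K hK).2 hKi) ((himproves K hK).2 hKJ)
  · intro h K hK hKi hKJ
    obtain ⟨K, hK', rfl⟩ := Finset.subset_image_iff.1 hK
    exact h K hK' ((hindep K hK').1 hKi) ((himproves K hK').1 hKJ)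

lemma existsUnique_optimal_image_iff (hψ : ψ.Injective)
    (hconf : ∀ x ∈ I, ∀ y ∈ I, conf' (ψ x) (ψ y) ↔ conf x y)
    (hprec : ∀ x ∈ I, ∀ y ∈ I, prec' (ψ x) (ψ y) ↔ prec x y) :
    (∃! J, Optimal (I.image ψ) conf' prec' J) ↔ ∃! J, Optimal I conf prec J := by
  constructor
  · rintro ⟨J, hJ, hu⟩
    obtain ⟨J, hJI, rfl⟩ := Finset.subset_image_iff.1 hJ.1
    refine ⟨J, (optimal_image_iff hψ hconf hprec hJI).1 hJ, fun K hK => ?_⟩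
    exact Finset.image_injective hψ (hu _ ((optimal_image_iff hψ hconf hprec hK.1).2 hK))
  · rintro ⟨J, hJ, hu⟩
    refine ⟨J.image ψ, (optimal_image_iff hψ hconf hprec hJ.1).2 hJ, fun K hK => ?_⟩
    obtain ⟨K, hKI, rfl⟩ := Finset.subset_image_iff.1 hK.1
    rw [hu K ((optimal_image_iff hψ hconf hprec hKI).1 hK)]

end Optimal

/-- Two facts conflict if together they violate the dependencies of the schema. -/
def Conflict (S : Schema) (f g : Fact S.sig) : Prop :=
  ¬ Satisfies {f, g} S.deps

section Repair

variable {S : Schema} {I J : Instance S.sig} {f g : Fact S.sig}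

lemma Conflict.symm (h : Conflict S f g) : Conflict S g f := by
  rwa [Conflict, Finset.pair_comm]

lemma mem_conflictGraph_iff {e : Finset (Fact S.sig)} :
    e ∈ conflictGraph S I ↔ ∃ f ∈ I, ∃ g ∈ I, e = {f, g} ∧ Conflict S f g := by
  simp only [conflictGraph, Set.mem_ofPred_eq, Conflict, Satisfies, not_forall, exists_prop]

lemma isConsistentSub_iff :
    IsConsistentSub I (conflictGraph S I) J ↔ J ⊆ I ∧ Indep (Conflict S) J := by
  refine and_congr_right fun hJ => ⟨fun h f hf g hg hfg => ?_, ?_⟩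
  · exact h {f, g} (mem_conflictGraph_iff.2 ⟨f, hJ hf, g, hJ hg, rfl, hfg⟩)
      (by simp [Finset.insert_subset_iff, hf, hg])
  · rintro h e he heJ
    obtain ⟨f, -, g, -, rfl, hfg⟩ := mem_conflictGraph_iff.1 he
    exact h f (heJ (by simp)) g (heJ (by simp)) hfg

lemma isGRepair_iff {prec : Fact S.sig → Fact S.sig → Prop} :
    IsGRepair I (conflictGraph S I) prec J ↔ Optimal I (Conflict S) prec J := by
  simp only [IsGRepair, IsGlobalImprovement, Optimal, Improves, isConsistentSub_iff,
    Finset.mem_sdiff, and_imp, and_assoc]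
  refine and_congr_right fun hJ => and_congr_right fun hJi => ?_
  simp only [hJ, hJi, true_and, not_exists, not_and]

lemma mem_gCategoricity_iff {D : Input S} :
    D ∈ GCategoricity S ↔
      ∃! J, Optimal D.facts.toFinset (Conflict S) (fun f g => (f, g) ∈ D.pairs) J :=
  existsUnique_congr fun _ => isGRepair_iff

lemma neighbors_of_conflict (hf : f ∈ I) (hg : g ∈ I) (h : Conflict S f g) :
    Neighbors (conflictGraph S I) f g :=
  ⟨{f, g}, mem_conflictGraph_iff.2 ⟨f, hf, g, hg, rfl, h⟩, by simp, by simp⟩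

lemma conflict_of_neighbors (hne : f ≠ g) (h : Neighbors (conflictGraph S I) f g) :
    Conflict S f g := by
  obtain ⟨e, he, hf, hg⟩ := h
  obtain ⟨f', -, g', -, rfl, h⟩ := mem_conflictGraph_iff.1 he
  simp only [Finset.mem_insert, Finset.mem_singleton] at hf hg
  rcases hf with rfl | rfl <;> rcases hg with rfl | rfl
  exacts [absurd rfl hne, h, h.symm, absurd rfl hne]

lemma conflict_of_mem_pairs (D : Input S) (h : (f, g) ∈ D.pairs) : Conflict S f g :=
  conflict_of_neighbors (fun hfg => D.valid.acyclic f (.single (by rwa [← hfg] at h)))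
    (D.valid.neighbors f g h)

lemma isPrioritizing_of_conflict {prec : Fact S.sig → Fact S.sig → Prop}
    (hmem : ∀ f g, prec f g → f ∈ I ∧ g ∈ I) (hacyclic : ∀ f, ¬ Relation.TransGen prec f f)
    (hconf : ∀ f g, prec f g → Conflict S f g) : IsPrioritizing I (conflictGraph S I) prec where
  edge_subset e he := by
    obtain ⟨f, hf, g, hg, rfl, -⟩ := mem_conflictGraph_iff.1 he
    exact Finset.insert_subset hf (Finset.singleton_subset_iff.2 hg)
  mem := hmem
  acyclic := hacyclic
  neighbors f g h := neighbors_of_conflict (hmem f g h).1 (hmem f g h).2 (hconf f g h)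

end Repair

/-! ### Violating sets of attributes -/

section Violating

/-- Two facts over `R` that agree exactly on the attributes in `Z` violate a dependency of `Δ`. -/
def Violating {σ : Signature} (Δ : Set (FD σ)) (R : Fin σ.num) (Z : Finset (Fin (σ.arity R))) :
    Prop :=
  ∃ X Y : Finset (Fin (σ.arity R)), (⟨R, X, Y⟩ : FD σ) ∈ Δ ∧ X ⊆ Z ∧ ¬ Y ⊆ Z

/-- The attributes on which two tuples agree. -/
def agreement {ι γ : Type*} [Fintype ι] [DecidableEq γ] (t u : ι → γ) : Finset ι :=
  Finset.univ.filter fun i => t i = u i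

section Agreement

variable {ι γ : Type*} [Fintype ι] [DecidableEq γ]

lemma mem_agreement {t u : ι → γ} {i : ι} : i ∈ agreement t u ↔ t i = u i := by
  simp [agreement]

lemma agreement_comm (t u : ι → γ) : agreement t u = agreement u t := by
  ext i
  simp only [mem_agreement, eq_comm]

lemma agreement_self (t : ι → γ) : agreement t t = Finset.univ := by
  simp [agreement]

lemma exists_agreement_eq [Nontrivial γ] (Z : Finset ι) : ∃ t u : ι → γ, agreement t u = Z := by
  classical
  obtain ⟨c, d, hcd⟩ := exists_pair_ne γ
  refine ⟨fun _ => c, fun i => if i ∈ Z then c else d, ?_⟩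
  ext i
  by_cases h : i ∈ Z <;> simp [mem_agreement, h, hcd]

end Agreement

variable {σ : Signature} {R : Fin σ.num} {Δ Δ' : Set (FD σ)}

lemma not_violating_univ : ¬ Violating Δ R Finset.univ :=
  fun ⟨_, Y, _, _, h⟩ => h (Finset.subset_univ Y)

lemma not_violating_inter {P Q : Finset (Fin (σ.arity R))} (hP : ¬ Violating Δ R P)
    (hQ : ¬ Violating Δ R Q) : ¬ Violating Δ R (P ∩ Q) := by
  rintro ⟨X, Y, hd, hX, hY⟩
  have hYP : Y ⊆ P := by_contra fun h => hP ⟨X, Y, hd, hX.trans Finset.inter_subset_left, h⟩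
  have hYQ : Y ⊆ Q := by_contra fun h => hQ ⟨X, Y, hd, hX.trans Finset.inter_subset_right, h⟩
  exact hY (Finset.subset_inter hYP hYQ)

lemma violating_singleton_iff {X Y Z : Finset (Fin (σ.arity R))} :
    Violating {⟨R, X, Y⟩} R Z ↔ X ⊆ Z ∧ ¬ Y ⊆ Z := by
  simp [Violating]

lemma satisfies_iff {I : Instance σ} :
    Satisfies I Δ ↔ ∀ (R : Fin σ.num) (t u : Fin (σ.arity R) → Const), (⟨R, t⟩ : Fact σ) ∈ I →
      (⟨R, u⟩ : Fact σ) ∈ I → ¬ Violating Δ R (agreement t u) := by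
  constructor
  · rintro h R t u ht hu ⟨X, Y, hd, hX, hY⟩
    refine hY fun i hi => mem_agreement.2 (h _ hd t u ht hu (fun j hj => ?_) i hi)
    exact mem_agreement.1 (hX hj)
  · rintro h ⟨R, X, Y⟩ hd t u ht hu hX i hi
    by_contra hne
    exact h R t u ht hu ⟨X, Y, hd, fun j hj => mem_agreement.2 (hX j hj),
      fun hY => hne (mem_agreement.1 (hY hi))⟩

lemma satisfies_pair_iff {t u : Fin (σ.arity R) → Const} :
    Satisfies {(⟨R, t⟩ : Fact σ), ⟨R, u⟩} Δ ↔ ¬ Violating Δ R (agreement t u) := by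
  rw [satisfies_iff]
  constructor
  · intro h
    exact h R t u (by simp) (by simp)
  · intro h R' t' u' ht hu
    simp only [Finset.mem_insert, Finset.mem_singleton] at ht hu
    obtain rfl : R' = R := by rcases ht with ht | ht <;> exact congrArg Sigma.fst ht
    simp only [Sigma.mk.injEq, heq_eq_eq, true_and] at ht hu
    rcases ht with rfl | rfl <;> rcases hu with rfl | rfl
    · rw [agreement_self]; exact not_violating_univ
    · exact h
    · rwa [agreement_comm]
    · rw [agreement_self]; exact not_violating_univ

lemma equivalent_iff :
    Equivalent Δ Δ' ↔ ∀ (R : Fin σ.num) (Z : Finset (Fin (σ.arity R))),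
      Violating Δ R Z ↔ Violating Δ' R Z := by
  constructor
  · intro h R Z
    obtain ⟨t, u, rfl⟩ := exists_agreement_eq (γ := Const) Z
    exact not_iff_not.1 (satisfies_pair_iff.symm.trans ((h _).trans satisfies_pair_iff))
  · intro h I
    simp only [satisfies_iff, h]

lemma conflict_iff {S : Schema} {R : Fin S.sig.num} {t u : Fin (S.sig.arity R) → Const} :
    Conflict S ⟨R, t⟩ ⟨R, u⟩ ↔ Violating S.deps R (agreement t u) := by
  rw [Conflict, satisfies_pair_iff, not_not]

lemma equivalent_depsOn_singleton_iff {S : Schema} {R : Fin S.sig.num}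
    {X Y : Finset (Fin (S.sig.arity R))} :
    Equivalent (S.depsOn R) {⟨R, X, Y⟩} ↔ ∀ Z, Violating S.deps R Z ↔ X ⊆ Z ∧ ¬ Y ⊆ Z := by
  have hdepsOn : ∀ Z, Violating (S.depsOn R) R Z ↔ Violating S.deps R Z := by
    simp [Violating, Schema.depsOn]
  rw [equivalent_iff]
  constructor
  · intro h Z
    rw [← hdepsOn, h, violating_singleton_iff]
  · intro h R' Z
    by_cases hR : R' = R
    · subst hR
      rw [hdepsOn, h, violating_singleton_iff]
    · refine iff_of_false ?_ ?_ <;> rintro ⟨X', Y', hd, -⟩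
      · exact hR hd.2
      · exact hR (congrArg FD.rel hd)

/-- A chain of two dependencies: `X₀ → Y₀` follows from the dependencies over `R`, the closed set
`Y₀` contains `X₀`, and the superset `X₁` of `Y₀` is not closed. -/
structure IsChain (S : Schema) (R : Fin S.sig.num) (X₀ Y₀ X₁ : Finset (Fin (S.sig.arity R))) :
    Prop where
  subset_closed : X₀ ⊆ Y₀
  closed_subset : Y₀ ⊆ X₁
  violating_left : Violating S.deps R X₀
  violating_of_subset : ∀ Z, X₀ ⊆ Z → ¬ Y₀ ⊆ Z → Violating S.deps R Z
  not_violating_closed : ¬ Violating S.deps R Y₀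
  violating_right : Violating S.deps R X₁

variable {S : Schema} {R : Fin S.sig.num}

lemma exists_least_violating
    (hinter : ∀ P Q, Violating S.deps R P → Violating S.deps R Q → Violating S.deps R (P ∩ Q))
    (hex : ∃ Z, Violating S.deps R Z) :
    ∃ X₀, Violating S.deps R X₀ ∧ ∀ Z, Violating S.deps R Z → X₀ ⊆ Z := by
  obtain ⟨X₀, hX₀⟩ := (Set.toFinite {Z | Violating S.deps R Z}).exists_minimal hex
  refine ⟨X₀, hX₀.prop, fun Z hZ => ?_⟩
  exact (hX₀.le_of_le (hinter X₀ Z hX₀.prop hZ) Finset.inter_subset_left).trans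
    Finset.inter_subset_right

lemma exists_least_not_violating (X₀ : Finset (Fin (S.sig.arity R))) :
    ∃ Y₀, X₀ ⊆ Y₀ ∧ ¬ Violating S.deps R Y₀ ∧
      ∀ Z, X₀ ⊆ Z → ¬ Y₀ ⊆ Z → Violating S.deps R Z := by
  obtain ⟨Y₀, hY₀⟩ := (Set.toFinite {Z | X₀ ⊆ Z ∧ ¬ Violating S.deps R Z}).exists_minimal
    ⟨Finset.univ, Finset.subset_univ _, not_violating_univ⟩
  refine ⟨Y₀, hY₀.prop.1, hY₀.prop.2, fun Z hZ hYZ => ?_⟩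
  by_contra hv
  exact hYZ ((hY₀.le_of_le ⟨Finset.subset_inter hY₀.prop.1 hZ,
    not_violating_inter hY₀.prop.2 hv⟩ Finset.inter_subset_left).trans Finset.inter_subset_right)

/-- If no chain exists and the violating sets are closed under intersection, then the least
violating set `X₀` and its closure `Y₀` give the dependency `X₀ → Y₀` equivalent to all others. -/
theorem exists_violating_inter_or_isChain
    (h : ∀ d : FD S.sig, d.rel = R → ¬ Equivalent (S.depsOn R) {d}) :
    (∃ P Q, Violating S.deps R P ∧ Violating S.deps R Q ∧ ¬ Violating S.deps R (P ∩ Q)) ∨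
      ∃ X₀ Y₀ X₁, IsChain S R X₀ Y₀ X₁ := by
  by_contra! hcon
  obtain ⟨hinter, hchain⟩ := hcon
  by_cases hex : ∃ Z, Violating S.deps R Z
  · obtain ⟨X₀, hX₀, hX₀le⟩ := exists_least_violating hinter hex
    obtain ⟨Y₀, hXY, hY₀, hclosure⟩ := exists_least_not_violating X₀
    refine h ⟨R, X₀, Y₀⟩ rfl (equivalent_depsOn_singleton_iff.2 fun Z =>
      ⟨fun hZ => ⟨hX₀le Z hZ, fun hYZ => ?_⟩, fun hZ => hclosure Z hZ.1 hZ.2⟩)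
    exact hchain X₀ Y₀ Z ⟨hXY, hYZ, hX₀, hclosure, hY₀, hZ⟩
  · push Not at hex
    exact h ⟨R, ∅, ∅⟩ rfl (equivalent_depsOn_singleton_iff.2 fun Z => by simp [hex])

end Violating

section SchemaZero

lemma violating_schemaZero_iff {Z : Finset (Fin 2)} :
    Violating schemaZero.deps (0 : Fin 1) Z ↔ (0 ∈ Z ∧ 1 ∉ Z) ∨ (1 ∈ Z ∧ 0 ∉ Z) := by
  constructor
  · rintro ⟨X, Y, hd | hd, hX, hY⟩ <;> cases hd
    · exact .inl (by simpa using And.intro hX hY)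
    · exact .inr (by simpa using And.intro hX hY)
  · rintro (⟨h₀, h₁⟩ | ⟨h₁, h₀⟩)
    · exact ⟨{(0 : Fin 2)}, {(1 : Fin 2)}, .inl rfl, by simpa using h₀, by simpa using h₁⟩
    · exact ⟨{(1 : Fin 2)}, {(0 : Fin 2)}, .inr rfl, by simpa using h₁, by simpa using h₀⟩

-- The sets `{A}` and `{B}` are violating, but their intersection is not.
theorem not_singleFDPerRelation_schemaZero : ¬ schemaZero.SingleFDPerRelation := by
  intro h
  obtain ⟨⟨R, X, Y⟩, hR, h⟩ := h (0 : Fin 1)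
  obtain rfl : R = (0 : Fin 1) := hR
  have hviol : ∀ Z : Finset (Fin 2), ((0 ∈ Z ∧ 1 ∉ Z) ∨ (1 ∈ Z ∧ 0 ∉ Z)) ↔
      (X : Finset (Fin 2)) ⊆ Z ∧ ¬ (Y : Finset (Fin 2)) ⊆ Z :=
    fun Z => violating_schemaZero_iff.symm.trans (equivalent_depsOn_singleton_iff.1 h Z)
  have hA := (hviol {0}).1 (by decide)
  have hB := (hviol {1}).1 (by decide)
  have hX : (X : Finset (Fin 2)) ⊆ ∅ := by
    rw [show (∅ : Finset (Fin 2)) = {0} ∩ {1} by decide]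
    exact Finset.subset_inter hA.1 hB.1
  have hY : (Y : Finset (Fin 2)) ⊆ ∅ := by
    by_contra hY
    exact absurd ((hviol ∅).2 ⟨hX, hY⟩) (by decide)
  exact hA.2 (hY.trans (Finset.empty_subset _))

lemma fact_sigZero_ext {f g : Fact sigZero} (ha : constA f = constA g)
    (hb : constB f = constB g) : f = g := by
  obtain ⟨R, t⟩ := f
  obtain ⟨R', u⟩ := g
  obtain rfl : R = R' := Subsingleton.elim (α := Fin 1) R R'
  congr 1
  funext i
  change Fin 2 at i
  fin_cases i
  exacts [ha, hb]

lemma conflict_schemaZero_iff {f g : Fact sigZero} :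
    Conflict schemaZero f g ↔ f ≠ g ∧ (constA f = constA g ∨ constB f = constB g) := by
  have hne : f ≠ g ↔ ¬ (constA f = constA g ∧ constB f = constB g) :=
    not_congr ⟨fun h => by simp [h], fun h => fact_sigZero_ext h.1 h.2⟩
  have hviol : Conflict schemaZero f g ↔
      (constA f = constA g ∧ ¬ constB f = constB g) ∨
        (constB f = constB g ∧ ¬ constA f = constA g) := by
    obtain ⟨R, t⟩ := f
    obtain ⟨R', u⟩ := g
    obtain rfl : R = (0 : Fin 1) := Subsingleton.elim (α := Fin 1) R 0
    obtain rfl : R' = (0 : Fin 1) := Subsingleton.elim (α := Fin 1) R' 0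
    rw [conflict_iff, violating_schemaZero_iff]
    simp only [mem_agreement]
    rfl
  rw [hviol, hne]
  tauto

end SchemaZero

/-! ### Existence of optimal sets -/

section Existence

variable {α : Type*} {conf prec : α → α → Prop} {I J J' : Finset α}

lemma exists_undominated (hacyclic : ∀ f, ¬ Relation.TransGen prec f f) (hI : I.Nonempty) :
    ∃ m ∈ I, ∀ x ∈ I, ¬ prec x m := by
  let r : I → I → Prop := fun x y => Relation.TransGen prec x y
  have : IsTrans I r := ⟨fun _ _ _ h h' => h.trans h'⟩
  have : Std.Irrefl r := ⟨fun x => hacyclic x⟩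
  have hwf : WellFounded r := Finite.wellFounded_of_trans_of_irrefl r
  obtain ⟨m, -, hm⟩ := hwf.has_min Set.univ ⟨⟨_, hI.choose_spec⟩, trivial⟩
  exact ⟨m, m.2, fun y hy h => hm ⟨y, hy⟩ trivial (.single h)⟩

lemma existsUnique_optimal_empty : ∃! J, Optimal ∅ conf prec J :=
  ⟨∅, ⟨subset_rfl, by simp [Indep], fun _ hK _ hi => hi.1 (Finset.subset_empty.1 hK)⟩,
    fun _ hJ => Finset.subset_empty.1 hJ.1⟩

lemma Indep.mono (hJ : Indep conf J) (h : J' ⊆ J) : Indep conf J' :=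
  fun f hf g hg => hJ f (h hf) g (h hg)

lemma Improves.of_insert [DecidableEq α] {m : α} {K : Finset α} (hmK : m ∈ K) (hmJ : m ∉ J)
    (h : Improves prec K (insert m J)) : Improves prec (K.erase m) J := by
  refine ⟨fun hKJ => h.1 (by rw [← hKJ, Finset.insert_erase hmK]), fun f hf hfK => ?_⟩
  have hfm : f ≠ m := ne_of_mem_of_not_mem hf hmJ
  obtain ⟨g, hg, hgJ, hgf⟩ := h.2 f (Finset.mem_insert_of_mem hf) fun hf' =>
    hfK (Finset.mem_erase.2 ⟨hfm, hf'⟩)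
  rw [Finset.mem_insert, not_or] at hgJ
  exact ⟨g, Finset.mem_erase.2 ⟨hgJ.1, hg⟩, hgJ.2, hgf⟩

open Classical in
lemma Optimal.insert {m : α} (hm : m ∈ I) (hmax : ∀ x ∈ I, ¬ prec x m) (hirrefl : ¬ conf m m)
    (hJ : Optimal (I.filter fun x => x ≠ m ∧ ¬ conf m x ∧ ¬ conf x m) conf prec J) :
    Optimal I conf prec (insert m J) := by
  have hmem : ∀ x ∈ J, x ∈ I ∧ x ≠ m ∧ ¬ conf m x ∧ ¬ conf x m := fun x hx =>
    Finset.mem_filter.1 (hJ.1 hx)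
  refine ⟨Finset.insert_subset hm fun x hx => (hmem x hx).1, fun f hf g hg => ?_, ?_⟩
  · rcases Finset.mem_insert.1 hf with rfl | hf' <;> rcases Finset.mem_insert.1 hg with rfl | hg'
    exacts [hirrefl, (hmem g hg').2.2.1, (hmem f hf').2.2.2, hJ.2.1 f hf' g hg']
  · intro K hK hKi himp
    have hmK : m ∈ K := by
      by_contra hmK
      obtain ⟨f, hf, -, hfm⟩ := himp.2 m (Finset.mem_insert_self m J) hmK
      exact hmax f (hK hf) hfm
    refine hJ.2.2 (K.erase m) (fun x hx => ?_) (hKi.mono (Finset.erase_subset m K))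
      (himp.of_insert hmK fun hmJ => (hmem m hmJ).2.1 rfl)
    obtain ⟨hxm, hxK⟩ := Finset.mem_erase.1 hx
    exact Finset.mem_filter.2 ⟨hK hxK, hxm, hKi m hmK x hxK, hKi x hxK m hmK⟩

theorem exists_optimal (hirrefl : ∀ f, ¬ conf f f) (hacyclic : ∀ f, ¬ Relation.TransGen prec f f)
    (I : Finset α) : ∃ J, Optimal I conf prec J := by
  classical
  induction I using Finset.strongInduction with
  | H I ih =>
    rcases I.eq_empty_or_nonempty with rfl | hI
    · exact existsUnique_optimal_empty.exists
    obtain ⟨m, hm, hmax⟩ := exists_undominated hacyclic hI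
    obtain ⟨J, hJ⟩ := ih (I.filter fun x => x ≠ m ∧ ¬ conf m x ∧ ¬ conf x m)
      (Finset.filter_ssubset.2 ⟨m, hm, fun h => h.1 rfl⟩)
    exact ⟨_, hJ.insert hm hmax (hirrefl m)⟩

lemma Optimal.not_subset (hJ : Optimal I conf prec J) (hJ' : Optimal I conf prec J')
    (hne : J ≠ J') : ¬ J ⊆ J' :=
  fun h => hJ.2.2 J' hJ'.1 hJ'.2.1 ⟨hne.symm, fun _ hf hf' => absurd (h hf) hf'⟩

end Existence

/-! ### Conflict relations with three layers -/

/-- The elements of `I` form three pairwise conflicting layers, given by their rank. Priorities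
lead from a layer to the one below it, and the last layer consists of an element `top` that has
priority over the whole middle layer. -/
structure IsLayered {α : Type*} (I : Finset α) (conf prec : α → α → Prop) (rank : α → ℕ)
    (top : α) : Prop where
  conf_of_rank_ne : ∀ x ∈ I, ∀ y ∈ I, rank x ≠ rank y → conf x y
  rank_of_prec : ∀ x ∈ I, ∀ y ∈ I, prec x y → rank x = rank y + 1
  top_mem : top ∈ I
  rank_top : rank top = 2
  eq_top : ∀ x ∈ I, rank x ≠ 0 → rank x ≠ 1 → x = top
  prec_top : ∀ x ∈ I, rank x = 1 → prec top x
  not_conf_top : ¬ conf top top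

/-- The set `J` is dominated by an independent subset of the middle layer. -/
def Refuted {α : Type*} (I : Finset α) (conf prec : α → α → Prop) (rank : α → ℕ)
    (J : Finset α) : Prop :=
  ∃ K ⊆ I, Indep conf K ∧ (∀ y ∈ K, rank y = 1) ∧ ∀ x ∈ J, ∃ y ∈ K, prec y x

namespace IsLayered

variable {α : Type*} {I J K : Finset α} {conf prec : α → α → Prop} {rank : α → ℕ} {top : α}

lemma rank_eq (h : IsLayered I conf prec rank top) (hJ : J ⊆ I) (hJi : Indep conf J) {x y : α}
    (hx : x ∈ J) (hy : y ∈ J) : rank x = rank y := by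
  by_contra hne
  exact hJi x hx y hy (h.conf_of_rank_ne x (hJ hx) y (hJ hy) hne)

lemma eq_singleton_top (h : IsLayered I conf prec rank top) (hJ : J ⊆ I) (hJi : Indep conf J)
    (htop : top ∈ J) : J = {top} := by
  refine Finset.eq_singleton_iff_unique_mem.2 ⟨htop, fun x hx => h.eq_top x (hJ hx) ?_ ?_⟩ <;>
    simp [h.rank_eq hJ hJi hx htop, h.rank_top]

lemma optimal_singleton_top (h : IsLayered I conf prec rank top) : Optimal I conf prec {top} := by
  refine ⟨Finset.singleton_subset_iff.2 h.top_mem, ?_, fun K hK hKi himp => ?_⟩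
  · simp only [Indep, Finset.mem_singleton, forall_eq]
    exact h.not_conf_top
  · by_cases htop : top ∈ K
    · exact himp.1 (h.eq_singleton_top hK hKi htop)
    · obtain ⟨f, hf, hftop, hprec⟩ := himp.2 top (Finset.mem_singleton_self top) htop
      have hrank := h.rank_of_prec f (hK hf) top h.top_mem hprec
      rw [h.rank_top] at hrank
      exact hftop (Finset.mem_singleton.2 (h.eq_top f (hK hf) (by lia) (by lia)))

lemma not_refuted_of_optimal (h : IsLayered I conf prec rank top) (hJ : Optimal I conf prec J)
    (hne : J ≠ {top}) : J.Nonempty ∧ (∀ x ∈ J, rank x = 0) ∧ ¬ Refuted I conf prec rank J := by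
  have hnot_improves : ¬ Improves prec {top} J :=
    hJ.2.2 _ h.optimal_singleton_top.1 h.optimal_singleton_top.2.1
  have htop : top ∉ J := fun htop => hne (h.eq_singleton_top hJ.1 hJ.2.1 htop)
  have hex : ∃ x ∈ J, rank x ≠ 1 := by
    by_contra! hrank
    exact hnot_improves ⟨hne.symm, fun x hx _ => ⟨top, Finset.mem_singleton_self top, htop,
      h.prec_top x (hJ.1 hx) (hrank x hx)⟩⟩
  obtain ⟨x, hx, hx₁⟩ := hex
  have hx₀ : rank x = 0 := by
    by_contra hx₀
    exact htop (h.eq_top x (hJ.1 hx) hx₀ hx₁ ▸ hx)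
  have hrank : ∀ y ∈ J, rank y = 0 := fun y hy => (h.rank_eq hJ.1 hJ.2.1 hy hx).trans hx₀
  refine ⟨⟨x, hx⟩, hrank, ?_⟩
  rintro ⟨K, hK, hKi, hK₁, hdom⟩
  have hdisj : ∀ y ∈ K, y ∉ J := fun y hy hyJ =>
    absurd ((hK₁ y hy).symm.trans (hrank y hyJ)) one_ne_zero
  refine hJ.2.2 K hK hKi ⟨fun hKJ => hdisj x (hKJ ▸ hx) hx, fun y hy _ => ?_⟩
  obtain ⟨z, hz, hzy⟩ := hdom y hy
  exact ⟨z, hz, hdisj z hz, hzy⟩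

lemma optimal_of_maximal (h : IsLayered I conf prec rank top) (hne : J.Nonempty)
    (hJ : Maximal (fun J => J ⊆ I ∧ Indep conf J ∧ ∀ x ∈ J, rank x = 0) J)
    (hrefuted : ¬ Refuted I conf prec rank J) : Optimal I conf prec J := by
  obtain ⟨hJI, hJi, hJ₀⟩ := hJ.prop
  refine ⟨hJI, hJi, fun K hK hKi himp => ?_⟩
  have hrank : ∀ y ∈ K, ∀ x ∈ J, prec y x → rank y = 1 := fun y hy x hx hyx => by
    rw [h.rank_of_prec y (hK hy) x (hJI hx) hyx, hJ₀ x hx]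
  by_cases hJK : J ⊆ K
  · obtain ⟨x, hx⟩ := hne
    have hK₀ : ∀ y ∈ K, rank y = 0 := fun y hy =>
      (h.rank_eq hK hKi hy (hJK hx)).trans (hJ₀ x hx)
    exact himp.1 ((hJ.le_of_ge ⟨hK, hKi, hK₀⟩ hJK).antisymm hJK)
  · obtain ⟨x, hx, hxK⟩ := Finset.not_subset.1 hJK
    obtain ⟨y, hy, -, hyx⟩ := himp.2 x hx hxK
    have hK₁ : ∀ z ∈ K, rank z = 1 := fun z hz =>
      (h.rank_eq hK hKi hz hy).trans (hrank y hy x hx hyx)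
    refine hrefuted ⟨K, hK, hKi, hK₁, fun z hz => ?_⟩
    obtain ⟨w, hw, -, hwz⟩ := himp.2 z hz fun hzK =>
      absurd ((hK₁ z hzK).symm.trans (hJ₀ z hz)) one_ne_zero
    exact ⟨w, hw, hwz⟩

lemma exists_optimal_ne_singleton_top (h : IsLayered I conf prec rank top) (hne : J.Nonempty)
    (hJ : J ⊆ I) (hJi : Indep conf J) (hJ₀ : ∀ x ∈ J, rank x = 0)
    (hrefuted : ¬ Refuted I conf prec rank J) : ∃ J', Optimal I conf prec J' ∧ J' ≠ {top} := by
  obtain ⟨J', hJJ', hJ'⟩ := (I.powerset.finite_toSet.subset fun J hJ =>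
    Finset.mem_coe.2 (Finset.mem_powerset.2 hJ.1)).exists_le_maximal
      (s := {J | J ⊆ I ∧ Indep conf J ∧ ∀ x ∈ J, rank x = 0}) ⟨hJ, hJi, hJ₀⟩
  refine ⟨J', h.optimal_of_maximal (hne.mono hJJ') hJ' ?_, ?_⟩
  · rintro ⟨K, hK, hKi, hK₁, hdom⟩
    exact hrefuted ⟨K, hK, hKi, hK₁, fun x hx => hdom x (hJJ' hx)⟩
  · rintro rfl
    simpa [h.rank_top] using hJ'.prop.2.2 top (Finset.mem_singleton_self top)

theorem existsUnique_optimal_iff (h : IsLayered I conf prec rank top) :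
    (∃! J, Optimal I conf prec J) ↔ ∀ J ⊆ I, Indep conf J → J.Nonempty →
      (∀ x ∈ J, rank x = 0) → Refuted I conf prec rank J := by
  constructor
  · intro huniq J hJ hJi hne hJ₀
    by_contra hrefuted
    obtain ⟨J', hJ', hJ'top⟩ := h.exists_optimal_ne_singleton_top hne hJ hJi hJ₀ hrefuted
    exact hJ'top (huniq.unique hJ' h.optimal_singleton_top)
  · intro hall
    refine ⟨{top}, h.optimal_singleton_top, fun J hJ => by_contra fun hne => ?_⟩
    obtain ⟨hJne, hJ₀, hrefuted⟩ := h.not_refuted_of_optimal hJ hne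
    exact hrefuted (hall J hJ.1 hJ.2.1 hJne hJ₀)

end IsLayered

/-! ### The kinds of nodes of the gadget -/

/-- The ways to refute a pair of candidate repairs: by an improvement of the candidate `c`, by an
inconsistency of the candidate `c`, or by the inclusion of the candidate `false` in the candidate
`true`. -/
inductive Mode
  | imp (c : Bool)
  | err (c : Bool)
  | sub
  deriving DecidableEq, Fintype

/-- The roles of a fact in a refutation. In an improvement of the candidate `c`, a fact belongs to
the improving set and, according to the refutation, to the candidate (`inn`), to the improving set
only (`str`), or not to the improving set (`out`). An inconsistency of the candidate `c` is claimed
for the row (`errA`) or the column (`errB`) of one fact, while the others are ignored (`skip`). In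
an inclusion, a fact belongs to both candidates (`both`), or it is missing from the candidate
`false` (`low`). -/
inductive Role
  | inn (c : Bool)
  | str (c : Bool)
  | out (c : Bool)
  | skip (c : Bool)
  | errA (c : Bool)
  | errB (c : Bool)
  | both
  | low
  deriving DecidableEq, Fintype

/-- The way of refutation to which a role belongs. -/
def Role.mode : Role → Mode
  | .inn c => .imp c
  | .str c => .imp c
  | .out c => .imp c
  | .skip c => .err c
  | .errA c => .err c
  | .errB c => .err c
  | .both => .sub
  | .low => .sub

/-- The kinds of nodes of the gadget. The kinds `pos c` and `neg c` say whether a fact belongs to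
the candidate `c`, while `row c` and `col c` say that it is the only fact of the candidate with its
first or second constant. A refutation consists of one `mode`, of a `role` for each fact, and of the
facts that are selected for their first constant (`rowSel`) and second constant (`colSel`). The
remaining kinds force a refutation to be complete: `gate` requires a role of the right mode, `goal`
requires a fact at which the refutation succeeds, and `keyA` and `keyB` require that the facts of an
improving set are selected. -/
inductive Kind
  | pos (c : Bool)
  | neg (c : Bool)
  | row (c : Bool)
  | col (c : Bool)
  | goal
  | keyA
  | keyB
  | gate (μ : Mode)
  | mode (μ : Mode)
  | role (v : Role)
  | rowSel
  | colSel
  | top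
  deriving DecidableEq, Fintype

/-- The block of a kind: pairs of candidates, refutations, and the node above all refutations. -/
def Kind.block : Kind → ℕ
  | .mode _ => 1
  | .role _ => 1
  | .rowSel => 1
  | .colSel => 1
  | .top => 2
  | _ => 0

/-- The template for the group of a node; distinct nodes of the same group conflict. -/
def Kind.group : Kind → AttrTemplate
  | .pos c => ⟨c.toNat, true, true⟩
  | .neg c => ⟨c.toNat, true, true⟩
  | .row c => ⟨2 + c.toNat, true, false⟩
  | .col c => ⟨4 + c.toNat, false, true⟩
  | .goal => ⟨6, false, false⟩
  | .keyA => ⟨7, true, true⟩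
  | .keyB => ⟨8, true, true⟩
  | .gate (.imp c) => ⟨9 + c.toNat, true, true⟩
  | .gate (.err c) => ⟨11 + c.toNat, true, true⟩
  | .gate .sub => ⟨13, true, true⟩
  | .mode _ => ⟨14, false, false⟩
  | .role _ => ⟨15, true, true⟩
  | .rowSel => ⟨16, true, false⟩
  | .colSel => ⟨17, false, true⟩
  | .top => ⟨18, false, false⟩

/-- Whether there is a node of the kind for each fact, rather than a single node. -/
def Kind.usesFact : Kind → Bool
  | .goal => false
  | .mode _ => false
  | .top => false
  | _ => true

/-- The kinds over which a mode has priority. -/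
def Mode.beats : Mode → Kind → Bool
  | .imp c, .pos c' => c' != c
  | .imp c, .neg c' => c' != c
  | .imp _, .row _ => true
  | .imp _, .col _ => true
  | .err c, .pos c' => c' != c
  | .err c, .neg c' => c' != c
  | .err c, .row c' => c' != c
  | .err c, .col c' => c' != c
  | .sub, .row _ => true
  | .sub, .col _ => true
  | .sub, .goal => true
  | μ, .gate μ' => μ' != μ
  | _, _ => false

/-- The kinds over which a role has priority, for nodes of the same fact. -/
def Role.beats : Role → Kind → Bool
  | .inn c, .pos c' => c' == c
  | .inn c, .neg c' => c' == c
  | .str c, .neg c' => c' == c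
  | .str _, .goal => true
  | .out c, .neg c' => c' == c
  | .out _, .keyA => true
  | .out _, .keyB => true
  | .skip c, .pos c' => c' == c
  | .skip c, .neg c' => c' == c
  | .skip c, .row c' => c' == c
  | .skip c, .col c' => c' == c
  | .skip _, .keyA => true
  | .skip _, .keyB => true
  | .errA c, .pos c' => c' == c
  | .errA c, .col c' => c' == c
  | .errA _, .goal => true
  | .errA _, .keyA => true
  | .errA _, .keyB => true
  | .errB c, .pos c' => c' == c
  | .errB c, .row c' => c' == c
  | .errB _, .goal => true
  | .errB _, .keyA => true
  | .errB _, .keyB => true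
  | .both, .pos _ => true
  | .both, .neg c' => !c'
  | .both, .keyA => true
  | .both, .keyB => true
  | .low, .pos c' => c'
  | .low, .neg _ => true
  | .low, .keyA => true
  | .low, .keyB => true
  | v, .gate μ => μ == v.mode
  | _, _ => false

/-- The priorities between nodes of the same fact. -/
def Kind.beats : Kind → Kind → Bool
  | .top, κ => κ.block == 1
  | .mode μ, κ => μ.beats κ
  | .role v, κ => v.beats κ
  | .rowSel, .keyA => true
  | .colSel, .keyB => true
  | _, _ => false

/-- The priorities between nodes of two facts, the first of which has priority over the second. -/
def Kind.lifts : Kind → Kind → Bool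
  | .role (.inn c), .pos c' => c' == c
  | .role (.str c), .pos c' => c' == c
  | _, _ => false

namespace Kind

lemma eq_top_of_block : ∀ κ : Kind, κ.block ≠ 0 → κ.block ≠ 1 → κ = .top := by decide

lemma usesFact_of_useA : ∀ κ : Kind, κ.group.useA = true → κ.usesFact = true := by decide

lemma usesFact_of_useB : ∀ κ : Kind, κ.group.useB = true → κ.usesFact = true := by decide

lemma block_of_beats : ∀ κ κ' : Kind, κ.beats κ' = true → κ.block = κ'.block + 1 := by decide

lemma block_of_lifts : ∀ κ κ' : Kind, κ.lifts κ' = true → κ.block = κ'.block + 1 := by decide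

lemma lifts_iff : ∀ κ κ' : Kind, κ.lifts κ' = true ↔
    ∃ c, (κ = .role (.inn c) ∨ κ = .role (.str c)) ∧ κ' = .pos c := by decide

lemma eq_mode_or_role_of_beats_gate : ∀ (μ : Mode) (κ : Kind), κ.beats (.gate μ) = true →
    (∃ μ', μ' ≠ μ ∧ κ = .mode μ') ∨ ∃ v : Role, v.mode = μ ∧ κ = .role v := by decide

lemma eq_or_pos_neg_of_group_eq : ∀ κ κ' : Kind, κ.block = 0 → κ.group = κ'.group →
    κ = κ' ∨ ∃ c, (κ = .pos c ∧ κ' = .neg c) ∨ (κ = .neg c ∧ κ' = .pos c) := by decide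

lemma eq_goal_of_skip : ∀ (c : Bool) (κ : Kind), κ.block = 0 → (Mode.err c).beats κ = false →
    (Role.skip c).beats κ = false → κ = .goal := by decide

lemma eq_neg_or_row_of_errA : ∀ (c : Bool) (κ : Kind), κ.block = 0 → (Mode.err c).beats κ = false →
    (Role.errA c).beats κ = false → κ = .neg c ∨ κ = .row c := by decide

lemma eq_neg_or_col_of_errB : ∀ (c : Bool) (κ : Kind), κ.block = 0 → (Mode.err c).beats κ = false →
    (Role.errB c).beats κ = false → κ = .neg c ∨ κ = .col c := by decide

lemma eq_goal_or_key_of_inn : ∀ (c : Bool) (κ : Kind), κ.block = 0 → (Mode.imp c).beats κ = false →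
    (Role.inn c).beats κ = false → κ = .goal ∨ κ = .keyA ∨ κ = .keyB := by decide

lemma eq_pos_or_key_of_str : ∀ (c : Bool) (κ : Kind), κ.block = 0 → (Mode.imp c).beats κ = false →
    (Role.str c).beats κ = false → κ = .pos c ∨ κ = .keyA ∨ κ = .keyB := by decide

lemma eq_pos_or_goal_of_out : ∀ (c : Bool) (κ : Kind), κ.block = 0 → (Mode.imp c).beats κ = false →
    (Role.out c).beats κ = false → κ = .pos c ∨ κ = .goal := by decide

lemma eq_neg_true_of_both : ∀ κ : Kind, κ.block = 0 → Mode.sub.beats κ = false →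
    Role.both.beats κ = false → κ = .neg true := by decide

lemma eq_pos_false_of_low : ∀ κ : Kind, κ.block = 0 → Mode.sub.beats κ = false →
    Role.low.beats κ = false → κ = .pos false := by decide

end Kind

namespace Role

lemma exists_mode_eq : ∀ μ : Mode, ∃ v : Role, v.mode = μ := by decide

lemma eq_inn : ∀ (v : Role) (c : Bool), v.mode = .imp c → v.beats (.pos c) = true →
    v = .inn c := by decide

lemma eq_str : ∀ (v : Role) (c : Bool), v.mode = .imp c → v.beats .goal = true →
    v = .str c := by decide

lemma not_beats_of_err : ∀ (v : Role) (c : Bool), v.mode = .err c → v.beats .goal = true →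
    v.beats (.neg c) = false ∧ (v.beats (.row c) = false ∨ v.beats (.col c) = false) := by decide

lemma not_beats_of_sub : ∀ v : Role, v.mode = .sub →
    v.beats (.pos false) = false ∨ v.beats (.neg true) = false := by decide

end Role

/-! ### Attacks on sets of nodes -/

/-- The nodes of kinds `κ` and `κ'` for the facts `f` and `f'` belong to the same group. -/
def SameGroup (κ : Kind) (f : Fact sigZero) (κ' : Kind) (f' : Fact sigZero) : Prop :=
  κ.group = κ'.group ∧ (κ.group.useA = true → constA f = constA f') ∧
    (κ.group.useB = true → constB f = constB f')

/-- The pairs `(κ, f)` and `(κ', f')` stand for the same node. -/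
def SameNode (κ : Kind) (f : Fact sigZero) (κ' : Kind) (f' : Fact sigZero) : Prop :=
  κ = κ' ∧ (κ.usesFact = true → f = f')

/-- A set of nodes that contains at most one node of each group. -/
def Coherent (X : Kind → Fact sigZero → Prop) : Prop :=
  ∀ κ f κ' f', X κ f → X κ' f' → SameGroup κ f κ' f' → SameNode κ f κ' f'

/-- A node of `Y` for a fact of `F` has priority over the node of kind `κ` for the fact `f`. -/
def Dominated (F : Finset (Fact sigZero)) (prec₀ : Fact sigZero → Fact sigZero → Prop)
    (Y : Kind → Fact sigZero → Prop) (κ : Kind) (f : Fact sigZero) : Prop :=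
  ∃ κ', ∃ g ∈ F, Y κ' g ∧
    ((κ'.beats κ = true ∧ (κ.usesFact = true → g = f)) ∨ (κ'.lifts κ = true ∧ prec₀ g f))

/-- The data of a refutation of a pair of candidates: a way of refutation, a role for each fact,
and the facts that are selected for their first and their second constants. -/
structure Attack where
  mode : Mode
  role : Fact sigZero → Role
  rows : Finset (Fact sigZero)
  cols : Finset (Fact sigZero)

namespace Attack

/-- All roles belong to the way of refutation, and no two selected facts share the constant for
which they are selected. -/
structure Valid (A : Attack) : Prop where
  mode_role : ∀ f, (A.role f).mode = A.mode
  injOn_rows : Set.InjOn constA (A.rows : Set (Fact sigZero))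
  injOn_cols : Set.InjOn constB (A.cols : Set (Fact sigZero))

/-- The nodes that represent an attack. -/
inductive Node (A : Attack) : Kind → Fact sigZero → Prop
  | mode {f} : A.Node (.mode A.mode) f
  | role {f} : A.Node (.role (A.role f)) f
  | row {f} : f ∈ A.rows → A.Node .rowSel f
  | col {f} : f ∈ A.cols → A.Node .colSel f

/-- The ways in which an attack dominates a node of a pair of candidates. -/
inductive Beats (A : Attack) (F : Finset (Fact sigZero))
    (prec₀ : Fact sigZero → Fact sigZero → Prop) : Kind → Fact sigZero → Prop
  | mode {κ f} : A.mode.beats κ = true → A.Beats F prec₀ κ f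
  | role {κ f} : (A.role f).beats κ = true → A.Beats F prec₀ κ f
  | goal {f g} : g ∈ F → (A.role g).beats .goal = true → A.Beats F prec₀ .goal f
  | row {f} : f ∈ A.rows → A.Beats F prec₀ .keyA f
  | col {f} : f ∈ A.cols → A.Beats F prec₀ .keyB f
  | lift {c f g} : g ∈ F → prec₀ g f → A.role g = .inn c ∨ A.role g = .str c →
      A.Beats F prec₀ (.pos c) f

variable {F : Finset (Fact sigZero)} {prec₀ : Fact sigZero → Fact sigZero → Prop} {A : Attack}
  {κ : Kind} {f : Fact sigZero}

lemma Node.block_eq (h : A.Node κ f) : κ.block = 1 := by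
  cases h <;> rfl

lemma Valid.coherent (hA : A.Valid) : Coherent A.Node := by
  rintro κ f κ' f' h h' ⟨hgroup, ha, hb⟩
  cases h <;> cases h' <;> try cases hgroup
  case mode.mode => exact ⟨rfl, by simp [Kind.usesFact]⟩
  case role.role => rw [fact_sigZero_ext (ha rfl) (hb rfl)]; exact ⟨rfl, fun _ => rfl⟩
  case row.row hf hf' => exact ⟨rfl, fun _ => hA.injOn_rows hf hf' (ha rfl)⟩
  case col.col hf hf' => exact ⟨rfl, fun _ => hA.injOn_cols hf hf' (hb rfl)⟩

lemma Beats.dominated (h : A.Beats F prec₀ κ f) (hf : f ∈ F) : Dominated F prec₀ A.Node κ f := by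
  cases h with
  | mode h => exact ⟨_, f, hf, .mode, .inl ⟨h, fun _ => rfl⟩⟩
  | role h => exact ⟨_, f, hf, .role, .inl ⟨h, fun _ => rfl⟩⟩
  | @goal _ g hg h => exact ⟨_, g, hg, .role, .inl ⟨h, by simp [Kind.usesFact]⟩⟩
  | row h => exact ⟨_, f, hf, .row h, .inl ⟨rfl, fun _ => rfl⟩⟩
  | col h => exact ⟨_, f, hf, .col h, .inl ⟨rfl, fun _ => rfl⟩⟩
  | @lift c _ g hg hgf h =>
    refine ⟨_, g, hg, .role, .inr ⟨(Kind.lifts_iff _ _).2 ⟨c, ?_, rfl⟩, hgf⟩⟩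
    exact h.imp (congrArg Kind.role) (congrArg Kind.role)

lemma beats_of_dominated {Y : Kind → Fact sigZero → Prop}
    (hY : ∀ κ, ∀ f ∈ F, Y κ f → A.Node κ f) (h : Dominated F prec₀ Y κ f) :
    A.Beats F prec₀ κ f := by
  obtain ⟨κ', g, hg, hκ', h⟩ := h
  have hnode := hY κ' g hg hκ'
  rcases h with ⟨hbeats, hgf⟩ | ⟨hlifts, hprec⟩
  · cases hnode with
    | mode => exact .mode hbeats
    | role =>
      by_cases hκ : κ.usesFact = true
      · exact .role (hgf hκ ▸ hbeats)
      · cases κ <;> try exact absurd rfl hκ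
        case goal => exact .goal hg hbeats
        all_goals simp [Kind.beats, Role.beats] at hbeats
    | row h =>
      cases κ <;> simp only [Kind.beats, Bool.false_eq_true] at hbeats
      exact .row (hgf rfl ▸ h)
    | col h =>
      cases κ <;> simp only [Kind.beats, Bool.false_eq_true] at hbeats
      exact .col (hgf rfl ▸ h)
  · obtain ⟨c, hrole, rfl⟩ := (Kind.lifts_iff _ _).1 hlifts
    cases hnode with
    | role => exact .lift hg hprec (by simpa using hrole)
    | _ => simp at hrole

end Attack

section OfDominated

variable {F : Finset (Fact sigZero)} {prec₀ : Fact sigZero → Fact sigZero → Prop}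
  {Y : Kind → Fact sigZero → Prop} {f g : Fact sigZero}

lemma Coherent.mode_eq (hY : Coherent Y) {μ μ' : Mode} (h : Y (.mode μ) f)
    (h' : Y (.mode μ') g) : μ = μ' :=
  Kind.mode.inj (hY _ _ _ _ h h' ⟨rfl, by simp [Kind.group]⟩).1

lemma Coherent.role_eq (hY : Coherent Y) {v v' : Role} (h : Y (.role v) f)
    (h' : Y (.role v') f) : v = v' :=
  Kind.role.inj (hY _ _ _ _ h h' ⟨rfl, fun _ => rfl, fun _ => rfl⟩).1

lemma Coherent.rowSel_injOn (hY : Coherent Y) : Set.InjOn constA {f | Y .rowSel f} :=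
  fun _ hf _ hg hfg => (hY _ _ _ _ hf hg ⟨rfl, fun _ => hfg, by simp [Kind.group]⟩).2 rfl

lemma Coherent.colSel_injOn (hY : Coherent Y) : Set.InjOn constB {f | Y .colSel f} :=
  fun _ hf _ hg hfg => (hY _ _ _ _ hf hg ⟨rfl, by simp [Kind.group], fun _ => hfg⟩).2 rfl

lemma Dominated.mode_or_role {μ : Mode} (h : Dominated F prec₀ Y (.gate μ) f) :
    (∃ μ', μ' ≠ μ ∧ ∃ g, Y (.mode μ') g) ∨ ∃ v : Role, v.mode = μ ∧ Y (.role v) f := by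
  obtain ⟨κ, g, -, hY, ⟨hbeats, hgf⟩ | ⟨hlifts, -⟩⟩ := h
  · obtain rfl := hgf rfl
    rcases Kind.eq_mode_or_role_of_beats_gate μ κ hbeats with ⟨μ', hne, rfl⟩ | ⟨v, hv, rfl⟩
    exacts [.inl ⟨μ', hne, g, hY⟩, .inr ⟨v, hv, hY⟩]
  · obtain ⟨c, -, hκ⟩ := (Kind.lifts_iff _ _).1 hlifts
    cases hκ

lemma Coherent.exists_mode (hY : Coherent Y) (hf : f ∈ F)
    (hgate : ∀ μ, ∀ f ∈ F, Dominated F prec₀ Y (.gate μ) f) :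
    ∃ μ g, Y (.mode μ) g ∧ ∀ f ∈ F, ∃ v : Role, v.mode = μ ∧ Y (.role v) f := by
  obtain ⟨μ, g, hμ⟩ : ∃ μ g, Y (.mode μ) g := by
    by_contra! hnone
    obtain ⟨v, hv, hvY⟩ := (hgate .sub f hf).mode_or_role.resolve_left
      fun ⟨μ', _, g, hg⟩ => hnone μ' g hg
    obtain ⟨v', hv', hvY'⟩ := (hgate (.imp true) f hf).mode_or_role.resolve_left
      fun ⟨μ', _, g, hg⟩ => hnone μ' g hg
    rw [hY.role_eq hvY hvY', hv'] at hv
    cases hv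
  exact ⟨μ, g, hμ, fun f hf => (hgate μ f hf).mode_or_role.resolve_left
    fun ⟨μ', hne, g', hg'⟩ => hne (hY.mode_eq hg' hμ)⟩

-- Facts outside `F` may be given any role of the right mode.
lemma Coherent.exists_attack (hY : Coherent Y) (hblock : ∀ κ f, Y κ f → κ.block = 1)
    (hF : F.Nonempty) (hgate : ∀ μ, ∀ f ∈ F, Dominated F prec₀ Y (.gate μ) f) :
    ∃ A : Attack, A.Valid ∧ ∀ κ, ∀ f ∈ F, Y κ f → A.Node κ f := by
  classical
  obtain ⟨μ, g, hμ, hrole⟩ := hY.exists_mode hF.choose_spec hgate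
  have hrole' : ∀ f, ∃ v : Role, v.mode = μ ∧ (f ∈ F → Y (.role v) f) := fun f => by
    by_cases hf : f ∈ F
    · exact (hrole f hf).imp fun v hv => ⟨hv.1, fun _ => hv.2⟩
    · exact (Role.exists_mode_eq μ).imp fun v hv => ⟨hv, fun hf' => absurd hf' hf⟩
  choose role hmode hrole using hrole'
  refine ⟨⟨μ, role, F.filter (Y .rowSel), F.filter (Y .colSel)⟩, ⟨hmode,
    hY.rowSel_injOn.mono fun _ hf => (Finset.mem_filter.1 hf).2,
    hY.colSel_injOn.mono fun _ hf => (Finset.mem_filter.1 hf).2⟩, fun κ f hf hκ => ?_⟩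
  have hκ₁ := hblock κ f hκ
  cases κ <;> try cases hκ₁
  case mode μ' => rw [hY.mode_eq hκ hμ]; exact .mode
  case role v => rw [hY.role_eq hκ (hrole f hf)]; exact .role
  case rowSel => exact .row (Finset.mem_filter.2 ⟨hf, hκ⟩)
  case colSel => exact .col (Finset.mem_filter.2 ⟨hf, hκ⟩)

end OfDominated

/-- Some node of `X` for a fact of `F` is not dominated by the attack. -/
def Withstands (F : Finset (Fact sigZero)) (prec₀ : Fact sigZero → Fact sigZero → Prop)
    (X : Kind → Fact sigZero → Prop) (A : Attack) : Prop :=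
  ∃ κ, ∃ f ∈ F, X κ f ∧ ¬ A.Beats F prec₀ κ f

/-! ### Pairs of optimal sets withstand all attacks -/

section Selected

/-- The nodes that represent the pair of candidates `J true` and `J false`. -/
def Selected (J : Bool → Finset (Fact sigZero)) : Kind → Fact sigZero → Prop
  | .pos c, f => f ∈ J c
  | .neg c, f => f ∉ J c
  | .row c, f => f ∈ J c
  | .col c, f => f ∈ J c
  | .goal, _ => True
  | .keyA, _ => True
  | .keyB, _ => True
  | .gate _, _ => True
  | _, _ => False

variable {F : Finset (Fact sigZero)} {prec₀ : Fact sigZero → Fact sigZero → Prop}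
  {J : Bool → Finset (Fact sigZero)} {A : Attack} {c : Bool} {κ : Kind} {f g : Fact sigZero}

lemma Selected.block_eq (h : Selected J κ f) : κ.block = 0 := by
  cases κ <;> first | rfl | exact h.elim

lemma indep_schemaZero_iff {L : Finset (Fact sigZero)} :
    Indep (Conflict schemaZero) L ↔
      Set.InjOn constA (L : Set (Fact sigZero)) ∧ Set.InjOn constB (L : Set (Fact sigZero)) := by
  simp only [Indep, conflict_schemaZero_iff, Set.InjOn, Finset.mem_coe]
  grind

lemma selected_coherent (hJ : ∀ c, Indep (Conflict schemaZero) (J c)) : Coherent (Selected J) := by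
  rintro κ f κ' f' h h' ⟨hgroup, ha, hb⟩
  rcases Kind.eq_or_pos_neg_of_group_eq κ κ' h.block_eq hgroup with
    rfl | ⟨c, ⟨rfl, rfl⟩ | ⟨rfl, rfl⟩⟩
  · refine ⟨rfl, fun hκ => ?_⟩
    cases κ with
    | row c => exact (indep_schemaZero_iff.1 (hJ c)).1 h h' (ha rfl)
    | col c => exact (indep_schemaZero_iff.1 (hJ c)).2 h h' (hb rfl)
    | goal => cases hκ
    | gate μ => rcases μ with c | c | _ <;> exact fact_sigZero_ext (ha rfl) (hb rfl)
    | _ => first | exact fact_sigZero_ext (ha rfl) (hb rfl) | exact h.elim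
  · exact absurd h (fact_sigZero_ext (ha rfl) (hb rfl) ▸ h')
  · exact absurd h' (fact_sigZero_ext (ha rfl) (hb rfl) ▸ h)

/-- The set that an attack proposes as an improvement of the candidate `c`. -/
def Attack.proposal (A : Attack) (F : Finset (Fact sigZero)) (c : Bool) : Finset (Fact sigZero) :=
  F.filter fun f => A.role f = .inn c ∨ A.role f = .str c

lemma Attack.Valid.indep_proposal (hA : A.Valid)
    (hkeyA : ∀ f ∈ F, A.Beats F prec₀ .keyA f) (hkeyB : ∀ f ∈ F, A.Beats F prec₀ .keyB f)
    (hmode : A.mode = .imp c) : Indep (Conflict schemaZero) (A.proposal F c) := by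
  refine indep_schemaZero_iff.2 ⟨hA.injOn_rows.mono fun f hf => ?_,
    hA.injOn_cols.mono fun f hf => ?_⟩
  all_goals obtain ⟨hf, hrole⟩ := Finset.mem_filter.1 hf
  · cases hkeyA f hf with
    | mode h => simp [hmode, Mode.beats] at h
    | role h => rcases hrole with hrole | hrole <;> simp [hrole, Role.beats] at h
    | row h => exact h
  · cases hkeyB f hf with
    | mode h => simp [hmode, Mode.beats] at h
    | role h => rcases hrole with hrole | hrole <;> simp [hrole, Role.beats] at h
    | col h => exact h

lemma Attack.Valid.inn_or_lift_of_beats_pos (hA : A.Valid) (hmode : A.mode = .imp c)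
    (h : A.Beats F prec₀ (.pos c) f) :
    A.role f = .inn c ∨ ∃ g ∈ A.proposal F c, prec₀ g f := by
  cases h with
  | mode h => simp [hmode, Mode.beats] at h
  | role h => exact .inl (Role.eq_inn _ _ ((hA.mode_role f).trans hmode) h)
  | @lift _ _ g hg hgf h => exact .inr ⟨g, Finset.mem_filter.2 ⟨hg, h⟩, hgf⟩

lemma Attack.exists_beats_goal (h : A.Beats F prec₀ .goal f) (hf : f ∈ F)
    (hmode : A.mode.beats .goal = false) : ∃ g ∈ F, (A.role g).beats .goal = true := by
  cases h with
  | mode h => simp [hmode] at h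
  | role h => exact ⟨f, hf, h⟩
  | goal hg h => exact ⟨_, hg, h⟩

lemma Attack.Valid.not_optimal_of_imp (hA : A.Valid)
    (hprec : ∀ f g, prec₀ f g → Conflict schemaZero f g) (hF : F.Nonempty)
    (hmode : A.mode = .imp c) (h : ∀ κ, ∀ f ∈ F, Selected J κ f → A.Beats F prec₀ κ f) :
    ¬ Optimal F (Conflict schemaZero) prec₀ (J c) := by
  intro hJ
  obtain ⟨e, he⟩ := hF
  have hindep : Indep (Conflict schemaZero) (A.proposal F c) := hA.indep_proposal
    (fun f hf => h .keyA f hf trivial) (fun f hf => h .keyB f hf trivial) hmode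
  have hpos : ∀ f ∈ J c, A.role f = .inn c ∨ ∃ g ∈ A.proposal F c, prec₀ g f := fun f hf =>
    hA.inn_or_lift_of_beats_pos hmode (h (.pos c) f (hJ.1 hf) hf)
  obtain ⟨g, hg, hgoal⟩ := exists_beats_goal (h .goal e he trivial) he (by rw [hmode]; rfl)
  have hstr : A.role g = .str c := Role.eq_str _ _ ((hA.mode_role g).trans hmode) hgoal
  have hgL : g ∈ A.proposal F c := Finset.mem_filter.2 ⟨hg, .inr hstr⟩
  have hgJ : g ∉ J c := fun hgJ => by
    rcases hpos g hgJ with hinn | ⟨g', hg', hprec'⟩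
    · simp [hstr] at hinn
    · exact hindep g' hg' g hgL (hprec _ _ hprec')
  refine hJ.2.2 _ (Finset.filter_subset _ _) hindep ⟨fun hL => hgJ (hL ▸ hgL), fun f hf hfL => ?_⟩
  rcases hpos f hf with hinn | ⟨g', hg', hprec'⟩
  · exact absurd (Finset.mem_filter.2 ⟨hJ.1 hf, .inl hinn⟩) hfL
  · exact ⟨g', hg', fun hg'J => hJ.2.1 g' hg'J f hf (hprec _ _ hprec'), hprec'⟩

lemma Attack.Valid.withstands_of_err (hA : A.Valid) (hF : F.Nonempty) (hmode : A.mode = .err c) :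
    Withstands F prec₀ (Selected J) A := by
  obtain ⟨e, he⟩ := hF
  by_cases hbeats : A.Beats F prec₀ .goal e
  swap; · exact ⟨.goal, e, he, trivial, hbeats⟩
  obtain ⟨g, hg, hgoal⟩ := exists_beats_goal hbeats he (by rw [hmode]; rfl)
  obtain ⟨hneg, hrow_or_col⟩ := Role.not_beats_of_err _ c ((hA.mode_role g).trans hmode) hgoal
  by_cases hgJ : g ∈ J c
  · rcases hrow_or_col with hrow | hcol
    · refine ⟨.row c, g, hg, hgJ, fun h => ?_⟩
      cases h <;> simp_all [Mode.beats]
    · refine ⟨.col c, g, hg, hgJ, fun h => ?_⟩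
      cases h <;> simp_all [Mode.beats]
  · refine ⟨.neg c, g, hg, hgJ, fun h => ?_⟩
    cases h <;> simp_all [Mode.beats]

lemma Attack.Valid.withstands_of_sub (hA : A.Valid) (hJF : J false ⊆ F)
    (hsub : ¬ J false ⊆ J true) (hmode : A.mode = .sub) : Withstands F prec₀ (Selected J) A := by
  obtain ⟨d, hd, hd'⟩ := Finset.not_subset.1 hsub
  rcases Role.not_beats_of_sub _ ((hA.mode_role d).trans hmode) with hpos | hneg
  · refine ⟨.pos false, d, hJF hd, hd, fun h => ?_⟩
    cases h with
    | mode h => simp [hmode, Mode.beats] at h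
    | role h => simp [hpos] at h
    | @lift _ _ g hg hgd h =>
      have hrole := (hA.mode_role g).trans hmode
      rcases h with h | h <;> simp [h, Role.mode] at hrole
  · refine ⟨.neg true, d, hJF hd, hd', fun h => ?_⟩
    cases h <;> simp_all [Mode.beats]

lemma Attack.Valid.withstands_selected (hA : A.Valid)
    (hprec : ∀ f g, prec₀ f g → Conflict schemaZero f g)
    (hJ : ∀ c, Optimal F (Conflict schemaZero) prec₀ (J c)) (hsub : ¬ J false ⊆ J true) :
    Withstands F prec₀ (Selected J) A := by
  have hF : F.Nonempty := (Finset.not_subset.1 hsub).imp fun d hd => (hJ false).1 hd.1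
  cases hmode : A.mode with
  | imp c =>
    by_contra h
    simp only [Withstands, not_exists, not_and, not_not] at h
    exact hA.not_optimal_of_imp hprec hF hmode h (hJ c)
  | err c => exact hA.withstands_of_err hF hmode
  | sub => exact hA.withstands_of_sub (hJ false).1 hsub hmode

end Selected

/-! ### Pairs of sets that withstand all attacks -/

section Candidate

open Classical in
/-- The set of the facts of `F` that belong to the candidate `c` according to the nodes `X`. -/
noncomputable def candidate (F : Finset (Fact sigZero)) (X : Kind → Fact sigZero → Prop)
    (c : Bool) : Finset (Fact sigZero) :=
  F.filter (X (.pos c))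

variable {F : Finset (Fact sigZero)} {prec₀ : Fact sigZero → Fact sigZero → Prop}
  {X : Kind → Fact sigZero → Prop} {c : Bool} {κ : Kind} {f g : Fact sigZero}

lemma mem_candidate : f ∈ candidate F X c ↔ f ∈ F ∧ X (.pos c) f := by
  simp [candidate]

lemma Coherent.not_pos_and_neg (hX : Coherent X) : ¬ (X (.pos c) f ∧ X (.neg c) f) :=
  fun ⟨hpos, hneg⟩ => by cases (hX _ _ _ _ hpos hneg ⟨rfl, fun _ => rfl, fun _ => rfl⟩).1

lemma Attack.beats_eq_false {A : Attack} (h : ¬ A.Beats F prec₀ κ f) :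
    A.mode.beats κ = false ∧ (A.role f).beats κ = false :=
  ⟨Bool.eq_false_iff.2 fun hmode => h (.mode hmode),
    Bool.eq_false_iff.2 fun hrole => h (.role hrole)⟩

/-- A coherent set of nodes for a pair of candidates that withstands all attacks. -/
structure IsDefense (F : Finset (Fact sigZero)) (prec₀ : Fact sigZero → Fact sigZero → Prop)
    (X : Kind → Fact sigZero → Prop) : Prop where
  block_eq : ∀ κ f, X κ f → κ.block = 0
  coherent : Coherent X
  withstands : ∀ A : Attack, A.Valid → Withstands F prec₀ X A

namespace IsDefense

lemma exists_not_beats_of_err (h : IsDefense F prec₀ X) {v : Role} (hf : f ∈ F)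
    (hv : v.mode = .err c) (hgoal : v.beats .goal = true) :
    ∃ κ, X κ f ∧ (Mode.err c).beats κ = false ∧ v.beats κ = false := by
  classical
  obtain ⟨κ, g, -, hκ, hnot⟩ := h.withstands
    ⟨.err c, fun g => if g = f then v else .skip c, ∅, ∅⟩
    ⟨fun g => by dsimp only; split_ifs; exacts [hv, rfl], by simp, by simp⟩
  obtain ⟨hmode, hrole⟩ := Attack.beats_eq_false hnot
  by_cases hgf : g = f
  · subst hgf
    exact ⟨κ, hκ, hmode, by simpa using hrole⟩
  · obtain rfl := Kind.eq_goal_of_skip c κ (h.block_eq κ g hκ) hmode (by simpa [hgf] using hrole)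
    exact absurd (.goal hf (by simpa using hgoal)) hnot

lemma row_and_col_of_pos (h : IsDefense F prec₀ X) (hf : f ∈ F) (hpos : X (.pos c) f) :
    X (.row c) f ∧ X (.col c) f := by
  have hneg : ¬ X (.neg c) f := fun hneg => h.coherent.not_pos_and_neg ⟨hpos, hneg⟩
  obtain ⟨κ, hκ, hmode, hrole⟩ := h.exists_not_beats_of_err (v := .errA c) hf rfl rfl
  obtain ⟨κ', hκ', hmode', hrole'⟩ := h.exists_not_beats_of_err (v := .errB c) hf rfl rfl
  constructor
  · rcases Kind.eq_neg_or_row_of_errA c κ (h.block_eq κ f hκ) hmode hrole with rfl | rfl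
    exacts [absurd hκ hneg, hκ]
  · rcases Kind.eq_neg_or_col_of_errB c κ' (h.block_eq κ' f hκ') hmode' hrole' with rfl | rfl
    exacts [absurd hκ' hneg, hκ']

lemma indep_candidate (h : IsDefense F prec₀ X) (c : Bool) :
    Indep (Conflict schemaZero) (candidate F X c) := by
  have hrow_col : ∀ f ∈ candidate F X c, X (.row c) f ∧ X (.col c) f := fun f hf =>
    h.row_and_col_of_pos (mem_candidate.1 hf).1 (mem_candidate.1 hf).2
  refine indep_schemaZero_iff.2 ⟨fun f hf g hg hfg => ?_, fun f hf g hg hfg => ?_⟩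
  · exact (h.coherent _ _ _ _ (hrow_col f hf).1 (hrow_col g hg).1
      ⟨rfl, fun _ => hfg, by simp [Kind.group]⟩).2 rfl
  · exact (h.coherent _ _ _ _ (hrow_col f hf).2 (hrow_col g hg).2
      ⟨rfl, by simp [Kind.group], fun _ => hfg⟩).2 rfl

lemma not_improves_candidate (h : IsDefense F prec₀ X) {K : Finset (Fact sigZero)}
    (hK : K ⊆ F) (hKi : Indep (Conflict schemaZero) K) : ¬ Improves prec₀ K (candidate F X c) := by
  classical
  rintro ⟨hne, himp⟩
  obtain ⟨e, he, heJ⟩ : ∃ e ∈ K, e ∉ candidate F X c := by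
    by_contra! hsub
    obtain ⟨f, hf, hfK⟩ := Finset.not_subset.1 fun h => hne (Finset.Subset.antisymm hsub h)
    obtain ⟨g, hg, hgJ, -⟩ := himp f hf hfK
    exact hgJ (hsub g hg)
  obtain ⟨hrows, hcols⟩ := indep_schemaZero_iff.1 hKi
  obtain ⟨κ, f, hf, hκ, hnot⟩ := h.withstands
    ⟨.imp c, fun f => if f ∈ K then (if f ∈ candidate F X c then .inn c else .str c) else .out c,
      K, K⟩ ⟨fun f => by dsimp only; split_ifs <;> rfl, hrows, hcols⟩
  have hκ₀ := h.block_eq κ f hκ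
  obtain ⟨hmode, hrole⟩ := Attack.beats_eq_false hnot
  have hgoal : κ ≠ .goal := by
    rintro rfl
    exact hnot (.goal (hK he) (by simp [he, heJ, Role.beats]))
  have hkey : f ∈ K → κ ≠ .keyA ∧ κ ≠ .keyB := fun hfK =>
    ⟨by rintro rfl; exact hnot (.row hfK), by rintro rfl; exact hnot (.col hfK)⟩
  by_cases hfK : f ∈ K <;> by_cases hfJ : f ∈ candidate F X c <;> simp only [hfK, hfJ] at hrole
  · have := Kind.eq_goal_or_key_of_inn c κ hκ₀ hmode hrole
    tauto
  · rcases Kind.eq_pos_or_key_of_str c κ hκ₀ hmode hrole with rfl | hκ'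
    exacts [hfJ (mem_candidate.2 ⟨hf, hκ⟩), by tauto]
  · obtain ⟨g, hg, hgJ, hgf⟩ := himp f hfJ hfK
    rcases Kind.eq_pos_or_goal_of_out c κ hκ₀ hmode hrole with rfl | hκ'
    exacts [hnot (.lift (hK hg) hgf (.inr (by simp [hg, hgJ]))), hgoal hκ']
  · rcases Kind.eq_pos_or_goal_of_out c κ hκ₀ hmode hrole with rfl | hκ'
    exacts [hfJ (mem_candidate.2 ⟨hf, hκ⟩), hgoal hκ']

lemma optimal_candidate (h : IsDefense F prec₀ X) (c : Bool) :
    Optimal F (Conflict schemaZero) prec₀ (candidate F X c) :=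
  ⟨fun _ hf => (mem_candidate.1 hf).1, h.indep_candidate c,
    fun _ hK hKi => h.not_improves_candidate hK hKi⟩

lemma not_candidate_subset (h : IsDefense F prec₀ X) :
    ¬ candidate F X false ⊆ candidate F X true := by
  classical
  intro hsub
  obtain ⟨κ, f, hf, hκ, hnot⟩ := h.withstands
    ⟨.sub, fun f => if f ∈ candidate F X false then .both else .low, ∅, ∅⟩
    ⟨fun f => by dsimp only; split_ifs <;> rfl, by simp, by simp⟩
  have hκ₀ := h.block_eq κ f hκ
  obtain ⟨hmode, hrole⟩ := Attack.beats_eq_false hnot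
  by_cases hfJ : f ∈ candidate F X false <;> simp only [hfJ] at hrole
  · obtain rfl := Kind.eq_neg_true_of_both κ hκ₀ hmode hrole
    exact h.coherent.not_pos_and_neg ⟨(mem_candidate.1 (hsub hfJ)).2, hκ⟩
  · obtain rfl := Kind.eq_pos_false_of_low κ hκ₀ hmode hrole
    exact hfJ (mem_candidate.2 ⟨hf, hκ⟩)

theorem not_existsUnique_optimal (h : IsDefense F prec₀ X) :
    ¬ ∃! J, Optimal F (Conflict schemaZero) prec₀ J :=
  fun huniq => h.not_candidate_subset
    (huniq.unique (h.optimal_candidate false) (h.optimal_candidate true)).subset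

end IsDefense

theorem exists_isDefense (hprec : ∀ f g, prec₀ f g → Conflict schemaZero f g)
    (hacyclic : ∀ f, ¬ Relation.TransGen prec₀ f f)
    (hnot : ¬ ∃! J, Optimal F (Conflict schemaZero) prec₀ J) :
    ∃ X, IsDefense F prec₀ X ∧ ∀ μ f, X (.gate μ) f := by
  have hirrefl : ∀ f : Fact sigZero, ¬ Conflict schemaZero f f := fun f hf =>
    (conflict_schemaZero_iff.1 hf).1 rfl
  obtain ⟨J, hJ⟩ := exists_optimal hirrefl hacyclic F
  obtain ⟨J', hJ', hne⟩ : ∃ J', Optimal F (Conflict schemaZero) prec₀ J' ∧ J' ≠ J := by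
    by_contra! h
    exact hnot ⟨J, hJ, h⟩
  have hopt : ∀ c : Bool, Optimal F (Conflict schemaZero) prec₀ (cond c J J') :=
    Bool.forall_bool.2 ⟨hJ', hJ⟩
  exact ⟨Selected fun c => cond c J J', ⟨fun _ _ => Selected.block_eq,
    selected_coherent fun c => (hopt c).2.1,
    fun A hA => hA.withstands_selected hprec hopt (hJ'.not_subset hJ hne)⟩, fun _ _ => trivial⟩

end Candidate

/-! ### The gadget -/

/-- The nodes `mk κ f`, their conflicts and their priorities form the gadget for the facts `F` with
the priority relation `prec₀`. -/
structure IsGadget {α : Type*} (F : Finset (Fact sigZero))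
    (prec₀ : Fact sigZero → Fact sigZero → Prop) (mk : Kind → Fact sigZero → α) (I : Finset α)
    (conf prec : α → α → Prop) : Prop where
  prec_conflict : ∀ f g, prec₀ f g → Conflict schemaZero f g
  prec_mem : ∀ f g, prec₀ f g → f ∈ F ∧ g ∈ F
  acyclic : ∀ f, ¬ Relation.TransGen prec₀ f f
  mk_eq_iff : ∀ κ f κ' f', mk κ f = mk κ' f' ↔ SameNode κ f κ' f'
  mem_iff : ∀ x, x ∈ I ↔ ∃ κ, ∃ f ∈ F, x = mk κ f
  conf_iff : ∀ κ f κ' f', conf (mk κ f) (mk κ' f') ↔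
    κ.block ≠ κ'.block ∨ (SameGroup κ f κ' f' ∧ ¬ SameNode κ f κ' f')
  prec_iff : ∀ x y, prec x y ↔
    (∃ κ κ', ∃ f ∈ F, κ.beats κ' = true ∧ x = mk κ f ∧ y = mk κ' f) ∨
      ∃ κ κ' f g, κ.lifts κ' = true ∧ prec₀ f g ∧ x = mk κ f ∧ y = mk κ' g

namespace IsGadget

variable {α : Type*} {F : Finset (Fact sigZero)} {prec₀ : Fact sigZero → Fact sigZero → Prop}
  {mk : Kind → Fact sigZero → α} {I J K : Finset α} {conf prec : α → α → Prop}
  {X : Kind → Fact sigZero → Prop} {x y : α} {κ : Kind} {f : Fact sigZero}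

/-- The block of a node; the value at elements that are not nodes is irrelevant. -/
noncomputable def rank (mk : Kind → Fact sigZero → α) : α → ℕ :=
  Function.extend (fun p : Kind × Fact sigZero => mk p.1 p.2) (fun p => p.1.block) 0

open Classical in
/-- The nodes for the facts of `F` that are described by `X`. -/
noncomputable def nodes (F : Finset (Fact sigZero)) (mk : Kind → Fact sigZero → α)
    (X : Kind → Fact sigZero → Prop) : Finset α :=
  ((Finset.univ ×ˢ F).filter fun p => X p.1 p.2).image fun p => mk p.1 p.2

lemma mem_nodes : x ∈ nodes F mk X ↔ ∃ κ, ∃ f ∈ F, X κ f ∧ x = mk κ f := by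
  simp only [nodes, Finset.mem_image, Finset.mem_filter, Finset.mem_product, Finset.mem_univ,
    true_and, Prod.exists, and_assoc, eq_comm]

lemma mk_mem_nodes (hf : f ∈ F) (h : X κ f) : mk κ f ∈ nodes F mk X :=
  mem_nodes.2 ⟨κ, f, hf, h, rfl⟩

lemma mk_mem (h : IsGadget F prec₀ mk I conf prec) (hf : f ∈ F) : mk κ f ∈ I :=
  (h.mem_iff _).2 ⟨κ, f, hf, rfl⟩

lemma nodes_subset (h : IsGadget F prec₀ mk I conf prec) : nodes F mk X ⊆ I := fun x hx => by
  obtain ⟨κ, f, hf, -, rfl⟩ := mem_nodes.1 hx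
  exact h.mk_mem hf

lemma rank_mk (h : IsGadget F prec₀ mk I conf prec) (κ : Kind) (f : Fact sigZero) :
    rank mk (mk κ f) = κ.block := by
  have hfactors : Function.FactorsThrough (fun p : Kind × Fact sigZero => p.1.block)
      (fun p => mk p.1 p.2) := fun p q hpq =>
    congrArg Kind.block ((h.mk_eq_iff _ _ _ _).1 hpq).1
  exact hfactors.extend_apply 0 (κ, f)

lemma rank_of_prec (h : IsGadget F prec₀ mk I conf prec) (hxy : prec x y) :
    rank mk x = rank mk y + 1 := by
  rcases (h.prec_iff x y).1 hxy with ⟨κ, κ', f, -, hbeats, rfl, rfl⟩ |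
    ⟨κ, κ', f, g, hlifts, -, rfl, rfl⟩
  · rw [h.rank_mk, h.rank_mk, Kind.block_of_beats κ κ' hbeats]
  · rw [h.rank_mk, h.rank_mk, Kind.block_of_lifts κ κ' hlifts]

lemma mem_of_prec (h : IsGadget F prec₀ mk I conf prec) (hxy : prec x y) : x ∈ I ∧ y ∈ I := by
  rcases (h.prec_iff x y).1 hxy with ⟨κ, κ', f, hf, -, rfl, rfl⟩ |
    ⟨κ, κ', f, g, -, hprec, rfl, rfl⟩
  · exact ⟨h.mk_mem hf, h.mk_mem hf⟩
  · exact ⟨h.mk_mem (h.prec_mem f g hprec).1, h.mk_mem (h.prec_mem f g hprec).2⟩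

lemma conf_of_rank_ne (h : IsGadget F prec₀ mk I conf prec) (hx : x ∈ I) (hy : y ∈ I)
    (hne : rank mk x ≠ rank mk y) : conf x y := by
  obtain ⟨κ, f, -, rfl⟩ := (h.mem_iff x).1 hx
  obtain ⟨κ', f', -, rfl⟩ := (h.mem_iff y).1 hy
  rw [h.rank_mk, h.rank_mk] at hne
  exact (h.conf_iff _ _ _ _).2 (.inl hne)

lemma conf_of_prec (h : IsGadget F prec₀ mk I conf prec) (hxy : prec x y) : conf x y :=
  h.conf_of_rank_ne (h.mem_of_prec hxy).1 (h.mem_of_prec hxy).2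
    (by rw [h.rank_of_prec hxy]; exact Nat.succ_ne_self _)

lemma acyclic_prec (h : IsGadget F prec₀ mk I conf prec) (x : α) :
    ¬ Relation.TransGen prec x x := by
  have hlt : ∀ y, Relation.TransGen prec x y → rank mk y < rank mk x := by
    intro y hy
    induction hy with
    | single hxy => exact (h.rank_of_prec hxy).symm ▸ Nat.lt_succ_self _
    | tail _ hyz ih => exact (Nat.lt_of_succ_le (h.rank_of_prec hyz).ge).trans ih
  exact fun hx => lt_irrefl _ (hlt x hx)

lemma isLayered (h : IsGadget F prec₀ mk I conf prec) (hf : f ∈ F) :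
    IsLayered I conf prec (rank mk) (mk .top f) where
  conf_of_rank_ne _ hx _ hy := h.conf_of_rank_ne hx hy
  rank_of_prec _ _ _ _ := h.rank_of_prec
  top_mem := h.mk_mem hf
  rank_top := h.rank_mk .top f
  eq_top x hx h₀ h₁ := by
    obtain ⟨κ, g, -, rfl⟩ := (h.mem_iff x).1 hx
    rw [h.rank_mk] at h₀ h₁
    obtain rfl := Kind.eq_top_of_block κ h₀ h₁
    exact (h.mk_eq_iff _ _ _ _).2 ⟨rfl, nofun⟩
  prec_top x hx h₁ := by
    obtain ⟨κ, g, hg, rfl⟩ := (h.mem_iff x).1 hx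
    rw [h.rank_mk] at h₁
    refine (h.prec_iff _ _).2 (.inl ⟨.top, κ, g, hg, beq_iff_eq.2 h₁, ?_, rfl⟩)
    exact (h.mk_eq_iff _ _ _ _).2 ⟨rfl, nofun⟩
  not_conf_top hconf := by
    simpa [SameNode] using (h.conf_iff _ _ _ _).1 hconf

lemma coherent_of_indep (h : IsGadget F prec₀ mk I conf prec) (hK : Indep conf K) :
    Coherent fun κ f => mk κ f ∈ K :=
  fun _ _ _ _ hf hf' hgroup => by_contra fun hne =>
    hK _ hf _ hf' ((h.conf_iff _ _ _ _).2 (.inr ⟨hgroup, hne⟩))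

lemma indep_nodes (h : IsGadget F prec₀ mk I conf prec) (hX : Coherent X) {n : ℕ}
    (hblock : ∀ κ f, X κ f → κ.block = n) : Indep conf (nodes F mk X) := by
  intro x hx y hy hxy
  obtain ⟨κ, f, -, hf, rfl⟩ := mem_nodes.1 hx
  obtain ⟨κ', f', -, hf', rfl⟩ := mem_nodes.1 hy
  rcases (h.conf_iff _ _ _ _).1 hxy with hne | ⟨hgroup, hne⟩
  · exact hne ((hblock κ f hf).trans (hblock κ' f' hf').symm)
  · exact hne (hX κ f κ' f' hf hf' hgroup)

lemma rank_eq_of_mem_nodes (h : IsGadget F prec₀ mk I conf prec) {n : ℕ}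
    (hblock : ∀ κ f, X κ f → κ.block = n) (hx : x ∈ nodes F mk X) : rank mk x = n := by
  obtain ⟨κ, f, -, hf, rfl⟩ := mem_nodes.1 hx
  rw [h.rank_mk, hblock κ f hf]

lemma exists_prec_iff_dominated (h : IsGadget F prec₀ mk I conf prec) :
    (∃ y ∈ K, prec y (mk κ f)) ↔ Dominated F prec₀ (fun κ f => mk κ f ∈ K) κ f := by
  constructor
  · rintro ⟨y, hy, hprec⟩
    rcases (h.prec_iff _ _).1 hprec with ⟨κ', κ'', g, hg, hbeats, rfl, heq⟩ |
      ⟨κ', κ'', g, g', hlifts, hgg', rfl, heq⟩ <;>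
      obtain ⟨rfl, hfg⟩ := (h.mk_eq_iff _ _ _ _).1 heq
    · exact ⟨κ', g, hg, hy, .inl ⟨hbeats, fun hκ => (hfg hκ).symm⟩⟩
    · obtain ⟨c, -, rfl⟩ := (Kind.lifts_iff _ _).1 hlifts
      obtain rfl := hfg rfl
      exact ⟨κ', g, (h.prec_mem _ _ hgg').1, hy, .inr ⟨hlifts, hgg'⟩⟩
  · rintro ⟨κ', g, hg, hy, ⟨hbeats, hgf⟩ | ⟨hlifts, hgf⟩⟩
    · have heq : mk κ f = mk κ g := (h.mk_eq_iff _ _ _ _).2 ⟨rfl, fun hκ => (hgf hκ).symm⟩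
      exact ⟨_, hy, (h.prec_iff _ _).2 (.inl ⟨κ', κ, g, hg, hbeats, rfl, heq⟩)⟩
    · exact ⟨_, hy, (h.prec_iff _ _).2 (.inr ⟨κ', κ, g, f, hlifts, hgf, rfl, rfl⟩)⟩

lemma not_refuted_nodes (h : IsGadget F prec₀ mk I conf prec) (hF : F.Nonempty)
    (hX : IsDefense F prec₀ X) (hgate : ∀ μ f, X (.gate μ) f) :
    ¬ Refuted I conf prec (rank mk) (nodes F mk X) := by
  rintro ⟨K, -, hK, hK₁, hprec⟩
  have hdom : ∀ κ, ∀ f ∈ F, X κ f → Dominated F prec₀ (fun κ f => mk κ f ∈ K) κ f :=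
    fun κ f hf hκ => h.exists_prec_iff_dominated.1 (hprec _ (mk_mem_nodes hf hκ))
  obtain ⟨A, hA, hnode⟩ := (h.coherent_of_indep hK).exists_attack
    (fun κ f hκ => (h.rank_mk κ f).symm.trans (hK₁ _ hκ)) hF
    fun μ f hf => hdom _ f hf (hgate μ f)
  obtain ⟨κ, f, hf, hκ, hnot⟩ := hX.withstands A hA
  exact hnot (Attack.beats_of_dominated hnode (hdom κ f hf hκ))

lemma isDefense_of_not_refuted (h : IsGadget F prec₀ mk I conf prec) (hJ : J ⊆ I)
    (hJi : Indep conf J) (hJ₀ : ∀ x ∈ J, rank mk x = 0)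
    (hrefuted : ¬ Refuted I conf prec (rank mk) J) :
    IsDefense F prec₀ fun κ f => mk κ f ∈ J where
  block_eq κ f hκ := (h.rank_mk κ f).symm.trans (hJ₀ _ hκ)
  coherent := h.coherent_of_indep hJi
  withstands A hA := by
    by_contra hnot
    simp only [Withstands, not_exists, not_and, not_not] at hnot
    have hblock : ∀ κ f, A.Node κ f → κ.block = 1 := fun _ _ => Attack.Node.block_eq
    refine hrefuted ⟨nodes F mk A.Node, h.nodes_subset, h.indep_nodes hA.coherent hblock,
      fun _ => h.rank_eq_of_mem_nodes hblock, fun x hx => ?_⟩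
    obtain ⟨κ, f, hf, rfl⟩ := (h.mem_iff x).1 (hJ hx)
    obtain ⟨κ', g, hg, hnode, hprec⟩ := (hnot κ f hf hx).dominated hf
    exact h.exists_prec_iff_dominated.2 ⟨κ', g, hg, mk_mem_nodes hg hnode, hprec⟩

theorem existsUnique_optimal_iff (h : IsGadget F prec₀ mk I conf prec) :
    (∃! J, Optimal I conf prec J) ↔ ∃! J, Optimal F (Conflict schemaZero) prec₀ J := by
  rcases F.eq_empty_or_nonempty with rfl | ⟨e, he⟩
  · obtain rfl : I = ∅ := Finset.eq_empty_of_forall_notMem fun x hx => by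
      simpa using (h.mem_iff x).1 hx
    exact iff_of_true existsUnique_optimal_empty existsUnique_optimal_empty
  rw [(h.isLayered he).existsUnique_optimal_iff]
  constructor
  · intro hall
    by_contra hnot
    obtain ⟨X, hX, hgate⟩ := exists_isDefense h.prec_conflict h.acyclic hnot
    exact h.not_refuted_nodes ⟨e, he⟩ hX hgate (hall _ h.nodes_subset
      (h.indep_nodes hX.coherent hX.block_eq) ⟨_, mk_mem_nodes he (hgate .sub e)⟩
      fun _ => h.rank_eq_of_mem_nodes hX.block_eq)
  · intro huniq J hJ hJi _ hJ₀
    by_contra hrefuted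
    exact (h.isDefense_of_not_refuted hJ hJi hJ₀ hrefuted).not_existsUnique_optimal huniq

end IsGadget

/-! ### The reductions -/

section Reduction

variable {S : Schema} {R : Fin S.sig.num}

/-- The facts that arise from the facts of `D` by means of templates. -/
def templateFacts (T₁ : List (Template (S.sig.arity R))) (D : Input schemaZero) :
    List (Fact S.sig) :=
  D.facts.flatMap fun φ => T₁.map fun τ => τ.fact φ

/-- The priorities that arise from the facts of `D` by means of the pairs of templates in `T₂`, and
from the priorities of `D` by means of those in `T₃`. -/
def templatePairs (T₂ T₃ : List (Template (S.sig.arity R) × Template (S.sig.arity R)))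
    (D : Input schemaZero) : List (Fact S.sig × Fact S.sig) :=
  (D.facts.flatMap fun φ => T₂.map fun t => (t.1.fact φ, t.2.fact φ)) ++
    D.pairs.flatMap fun p => T₃.map fun t => (t.1.fact p.1, t.2.fact p.2)

theorem GCategoricityCoNPHard.of_template (h : GCategoricityCoNPHard schemaZero)
    (T₁ : List (Template (S.sig.arity R)))
    (T₂ T₃ : List (Template (S.sig.arity R) × Template (S.sig.arity R)))
    (hmem : ∀ D f g, (f, g) ∈ templatePairs T₂ T₃ D →
      f ∈ (templateFacts T₁ D).toFinset ∧ g ∈ (templateFacts T₁ D).toFinset)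
    (hacyclic : ∀ D f, ¬ Relation.TransGen (fun f g => (f, g) ∈ templatePairs T₂ T₃ D) f f)
    (hconf : ∀ D f g, (f, g) ∈ templatePairs T₂ T₃ D → Conflict S f g)
    (hiff : ∀ D : Input schemaZero,
      (∃! J, Optimal (templateFacts T₁ D).toFinset (Conflict S)
        (fun f g => (f, g) ∈ templatePairs T₂ T₃ D) J) ↔
      ∃! J, Optimal D.facts.toFinset (Conflict schemaZero) (fun f g => (f, g) ∈ D.pairs) J) :
    GCategoricityCoNPHard S := by
  intro L hL
  obtain ⟨f, hf, hfL⟩ := h L hL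
  refine ⟨fun x => ⟨templateFacts T₁ (f x), templatePairs T₂ T₃ (f x),
    isPrioritizing_of_conflict (hmem _) (hacyclic _) (hconf _)⟩,
    hf.template T₁ T₂ T₃ _ (fun _ => rfl) (fun _ => rfl), fun x => ?_⟩
  rw [hfL, mem_gCategoricity_iff, mem_gCategoricity_iff]
  exact (hiff (f x)).symm

lemma Violating.exists_notMem {Z : Finset (Fin (S.sig.arity R))} (h : Violating S.deps R Z) :
    ∃ j, j ∉ Z := by
  by_contra! hcon
  exact not_violating_univ (Finset.eq_univ_of_forall hcon ▸ h)

lemma Template.conflict_fact_iff {τ τ' : Template (S.sig.arity R)} {f g : Fact sigZero} :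
    Conflict S (τ.fact (R := R) f) (τ'.fact (R := R) g) ↔
      Violating S.deps R (agreement (τ.tuple f) (τ'.tuple g)) :=
  conflict_iff

/-! ### Violating sets with a non-violating intersection -/

section Grid

/-- The template whose facts agree on `P` if the first constants agree, and on `Q` if the second
constants agree. -/
def gridTemplate {k : ℕ} (P Q : Finset (Fin k)) : Template k :=
  fun j => ⟨0, decide (j ∉ Q), decide (j ∉ P)⟩

variable {P Q : Finset (Fin (S.sig.arity R))} {f g : Fact sigZero}

lemma mem_agreement_gridTemplate {k : ℕ} {P Q : Finset (Fin k)} {j : Fin k} :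
    j ∈ agreement ((gridTemplate P Q).tuple f) ((gridTemplate P Q).tuple g) ↔
      (j ∉ Q → constA f = constA g) ∧ (j ∉ P → constB f = constB g) := by
  simp [mem_agreement, Template.tuple, AttrTemplate.value_inj, gridTemplate]

lemma gridTemplate_fact_injective (hP : Violating S.deps R P) (hQ : Violating S.deps R Q) :
    Function.Injective ((gridTemplate P Q).fact : Fact sigZero → Fact S.sig) := by
  intro f g hfg
  have hagree : ∀ j, (j ∉ Q → constA f = constA g) ∧ (j ∉ P → constB f = constB g) := fun j =>
    mem_agreement_gridTemplate.1 (mem_agreement.2 (congrFun (Template.fact_inj.1 hfg) j))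
  obtain ⟨i, hi⟩ := hP.exists_notMem
  obtain ⟨j, hj⟩ := hQ.exists_notMem
  exact fact_sigZero_ext ((hagree j).1 hj) ((hagree i).2 hi)

lemma conflict_gridTemplate_iff (hP : Violating S.deps R P) (hQ : Violating S.deps R Q)
    (hPQ : ¬ Violating S.deps R (P ∩ Q)) :
    Conflict S ((gridTemplate P Q).fact (R := R) f) ((gridTemplate P Q).fact (R := R) g) ↔
      Conflict schemaZero f g := by
  rw [Template.conflict_fact_iff, conflict_schemaZero_iff]
  obtain rfl | hne := eq_or_ne f g
  · rw [agreement_self]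
    exact iff_of_false not_violating_univ fun h => h.1 rfl
  by_cases ha : constA f = constA g <;> by_cases hb : constB f = constB g
  · exact absurd (fact_sigZero_ext ha hb) hne
  · rw [show agreement _ _ = P by ext j; simp [mem_agreement_gridTemplate, ha, hb]]
    exact iff_of_true hP ⟨hne, .inl ha⟩
  · rw [show agreement _ _ = Q by ext j; simp [mem_agreement_gridTemplate, ha, hb]]
    exact iff_of_true hQ ⟨hne, .inr hb⟩
  · rw [show agreement _ _ = P ∩ Q by
      ext j; simp [mem_agreement_gridTemplate, ha, hb, and_comm]]
    exact iff_of_false hPQ (by simp [ha, hb])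

lemma toFinset_templateFacts_singleton (τ : Template (S.sig.arity R)) (D : Input schemaZero) :
    (templateFacts [τ] D).toFinset = D.facts.toFinset.image τ.fact := by
  ext x
  simp [templateFacts, eq_comm]

lemma mem_templatePairs_singleton {τ : Template (S.sig.arity R)} {D : Input schemaZero}
    {x y : Fact S.sig} :
    (x, y) ∈ templatePairs [] [(τ, τ)] D ↔
      ∃ f g, (f, g) ∈ D.pairs ∧ τ.fact f = x ∧ τ.fact g = y := by
  simp [templatePairs, eq_comm]

lemma not_transGen_templatePairs_singleton {τ : Template (S.sig.arity R)}
    (hτ : Function.Injective (τ.fact : Fact sigZero → Fact S.sig)) (D : Input schemaZero)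
    (x : Fact S.sig) :
    ¬ Relation.TransGen (fun x y => (x, y) ∈ templatePairs [] [(τ, τ)] D) x x := fun hx => by
  obtain ⟨ρ, hρ⟩ := hτ.hasLeftInverse
  refine D.valid.acyclic (ρ x) (hx.lift ρ fun y z hyz => ?_)
  obtain ⟨f, g, hfg, rfl, rfl⟩ := mem_templatePairs_singleton.1 hyz
  simpa only [Function.onFun, hρ f, hρ g] using hfg

theorem GCategoricityCoNPHard.of_violating_inter (h : GCategoricityCoNPHard schemaZero)
    (hP : Violating S.deps R P) (hQ : Violating S.deps R Q)
    (hPQ : ¬ Violating S.deps R (P ∩ Q)) : GCategoricityCoNPHard S := by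
  have hinj := gridTemplate_fact_injective hP hQ
  refine h.of_template [gridTemplate P Q] [] [(gridTemplate P Q, gridTemplate P Q)]
    (fun D x y hxy => ?_) (not_transGen_templatePairs_singleton hinj) (fun D x y hxy => ?_)
    fun D => ?_
  · obtain ⟨f, g, hfg, rfl, rfl⟩ := mem_templatePairs_singleton.1 hxy
    rw [toFinset_templateFacts_singleton]
    exact (D.valid.mem f g hfg).imp (Finset.mem_image_of_mem _) (Finset.mem_image_of_mem _)
  · obtain ⟨f, g, hfg, rfl, rfl⟩ := mem_templatePairs_singleton.1 hxy
    exact (conflict_gridTemplate_iff hP hQ hPQ).2 (conflict_of_mem_pairs D hfg)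
  · rw [toFinset_templateFacts_singleton]
    refine existsUnique_optimal_image_iff hinj
      (fun _ _ _ _ => conflict_gridTemplate_iff hP hQ hPQ) fun f _ g _ => ?_
    rw [mem_templatePairs_singleton]
    constructor
    · rintro ⟨f', g', hfg, hf, hg⟩
      rwa [hinj hf, hinj hg] at hfg
    · exact fun hfg => ⟨f, g, hfg, rfl, rfl⟩

end Grid

/-! ### A chain of two dependencies -/

section Chain

variable {X₀ Y₀ X₁ : Finset (Fin (S.sig.arity R))} {κ κ' : Kind} {f f' : Fact sigZero}

/-- The template for the nodes of a kind. All nodes agree on `X₀`, nodes of the same block agree on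
`Y₀`, and nodes of the same group agree on `X₁`; the remaining attributes identify the node. -/
noncomputable def nodeTemplate {k : ℕ} (X₀ Y₀ X₁ : Finset (Fin k)) (κ : Kind) : Template k :=
  fun j =>
    if j ∈ X₀ then ⟨0, false, false⟩
    else if j ∈ Y₀ then ⟨κ.block, false, false⟩
    else if j ∈ X₁ then κ.group
    else ⟨Fintype.equivFin Kind κ, κ.usesFact, κ.usesFact⟩

lemma mem_agreement_nodeTemplate {k : ℕ} {X₀ Y₀ X₁ : Finset (Fin k)} {j : Fin k} :
    j ∈ agreement ((nodeTemplate X₀ Y₀ X₁ κ).tuple f) ((nodeTemplate X₀ Y₀ X₁ κ').tuple f') ↔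
      if j ∈ X₀ then True else if j ∈ Y₀ then κ.block = κ'.block
      else if j ∈ X₁ then SameGroup κ f κ' f' else SameNode κ f κ' f' := by
  rw [mem_agreement, Template.tuple, Template.tuple, AttrTemplate.value_inj]
  unfold nodeTemplate
  split_ifs
  · simp
  · simp
  · rfl
  · simp only [AttrTemplate.mk.injEq, Fin.val_inj, EmbeddingLike.apply_eq_iff_eq]
    constructor
    · rintro ⟨⟨hκ, -⟩, ha, hb⟩
      exact ⟨hκ, fun hu => fact_sigZero_ext (ha hu) (hb hu)⟩
    · rintro ⟨rfl, hf⟩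
      exact ⟨⟨rfl, rfl, rfl⟩, fun hu => by rw [hf hu], fun hu => by rw [hf hu]⟩

lemma SameNode.sameGroup (h : SameNode κ f κ' f') : SameGroup κ f κ' f' := by
  obtain ⟨rfl, hf⟩ := h
  exact ⟨rfl, fun hu => by rw [hf (κ.usesFact_of_useA hu)],
    fun hu => by rw [hf (κ.usesFact_of_useB hu)]⟩

lemma agreement_nodeTemplate_of_sameNode (h : SameNode κ f κ' f') :
    agreement ((nodeTemplate X₀ Y₀ X₁ κ).tuple f) ((nodeTemplate X₀ Y₀ X₁ κ').tuple f') =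
      Finset.univ := by
  refine Finset.eq_univ_of_forall fun j => mem_agreement_nodeTemplate.2 ?_
  split_ifs
  exacts [congrArg Kind.block h.1, h.sameGroup, h]

/-- The templates for the pairs of kinds that satisfy `r`. -/
noncomputable def nodeTemplatePairs {k : ℕ} (X₀ Y₀ X₁ : Finset (Fin k)) (r : Kind → Kind → Bool) :
    List (Template k × Template k) :=
  (Finset.univ.filter fun p : Kind × Kind => r p.1 p.2 = true).toList.map
    fun p => (nodeTemplate X₀ Y₀ X₁ p.1, nodeTemplate X₀ Y₀ X₁ p.2)

lemma mem_nodeTemplatePairs {k : ℕ} {X₀ Y₀ X₁ : Finset (Fin k)} {r : Kind → Kind → Bool}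
    {t : Template k × Template k} :
    t ∈ nodeTemplatePairs X₀ Y₀ X₁ r ↔
      ∃ κ κ', r κ κ' = true ∧ t = (nodeTemplate X₀ Y₀ X₁ κ, nodeTemplate X₀ Y₀ X₁ κ') := by
  simp only [nodeTemplatePairs, List.mem_map, Finset.mem_toList, Finset.mem_filter,
    Finset.mem_univ, true_and, Prod.exists, eq_comm (b := t)]

namespace IsChain

lemma agreement_nodeTemplate_of_sameGroup (h : IsChain S R X₀ Y₀ X₁)
    (hblock : κ.block = κ'.block) (hgroup : SameGroup κ f κ' f') (hnode : ¬ SameNode κ f κ' f') :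
    agreement ((nodeTemplate X₀ Y₀ X₁ κ).tuple f) ((nodeTemplate X₀ Y₀ X₁ κ').tuple f') =
      X₁ := by
  ext j
  have hXY := @h.subset_closed j
  have hYX := @h.closed_subset j
  rw [mem_agreement_nodeTemplate]
  split_ifs <;> tauto

lemma agreement_nodeTemplate_of_not_sameGroup (h : IsChain S R X₀ Y₀ X₁)
    (hblock : κ.block = κ'.block) (hgroup : ¬ SameGroup κ f κ' f') :
    agreement ((nodeTemplate X₀ Y₀ X₁ κ).tuple f) ((nodeTemplate X₀ Y₀ X₁ κ').tuple f') =
      Y₀ := by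
  ext j
  have hXY := @h.subset_closed j
  have hnode : ¬ SameNode κ f κ' f' := fun hnode => hgroup hnode.sameGroup
  rw [mem_agreement_nodeTemplate]
  split_ifs <;> tauto

lemma violating_agreement_of_block_ne (h : IsChain S R X₀ Y₀ X₁)
    (hblock : κ.block ≠ κ'.block) :
    Violating S.deps R
      (agreement ((nodeTemplate X₀ Y₀ X₁ κ).tuple f) ((nodeTemplate X₀ Y₀ X₁ κ').tuple f')) := by
  obtain ⟨j, hjY, hjX⟩ : ∃ j ∈ Y₀, j ∉ X₀ := by
    by_contra! hsub
    exact h.not_violating_closed (h.subset_closed.antisymm hsub ▸ h.violating_left)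
  refine h.violating_of_subset _ (fun i hi => ?_) fun hsub => hblock ?_
  · rw [mem_agreement_nodeTemplate, if_pos hi]
    trivial
  · simpa only [mem_agreement_nodeTemplate, if_neg hjX, if_pos hjY] using hsub hjY

lemma nodeTemplate_fact_eq_iff (h : IsChain S R X₀ Y₀ X₁) :
    (nodeTemplate X₀ Y₀ X₁ κ).fact (R := R) f = (nodeTemplate X₀ Y₀ X₁ κ').fact f' ↔
      SameNode κ f κ' f' := by
  rw [Template.fact_inj]
  constructor
  · intro heq
    obtain ⟨j, hj₁⟩ := h.violating_right.exists_notMem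
    have hjY := fun hjY => hj₁ (h.closed_subset hjY)
    have hjX := fun hjX => hjY (h.subset_closed hjX)
    simpa only [mem_agreement_nodeTemplate, if_neg hj₁, if_neg hjY, if_neg hjX] using
      mem_agreement.2 (congrFun heq j)
  · intro hnode
    funext j
    rw [← mem_agreement, agreement_nodeTemplate_of_sameNode hnode]
    exact Finset.mem_univ j

lemma conflict_nodeTemplate_iff (h : IsChain S R X₀ Y₀ X₁) :
    Conflict S ((nodeTemplate X₀ Y₀ X₁ κ).fact (R := R) f)
        ((nodeTemplate X₀ Y₀ X₁ κ').fact (R := R) f') ↔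
      κ.block ≠ κ'.block ∨ (SameGroup κ f κ' f' ∧ ¬ SameNode κ f κ' f') := by
  rw [Template.conflict_fact_iff]
  by_cases hblock : κ.block = κ'.block
  · by_cases hgroup : SameGroup κ f κ' f'
    · by_cases hnode : SameNode κ f κ' f'
      · rw [agreement_nodeTemplate_of_sameNode hnode]
        exact iff_of_false not_violating_univ (by simp [hblock, hnode])
      · rw [h.agreement_nodeTemplate_of_sameGroup hblock hgroup hnode]
        exact iff_of_true h.violating_right (.inr ⟨hgroup, hnode⟩)
    · rw [h.agreement_nodeTemplate_of_not_sameGroup hblock hgroup]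
      exact iff_of_false h.not_violating_closed (by simp [hblock, hgroup])
  · exact iff_of_true (h.violating_agreement_of_block_ne hblock) (.inl hblock)

lemma isGadget (h : IsChain S R X₀ Y₀ X₁) (D : Input schemaZero) :
    IsGadget D.facts.toFinset (fun f g => (f, g) ∈ D.pairs)
      (fun κ => (nodeTemplate X₀ Y₀ X₁ κ).fact (R := R))
      (templateFacts (Finset.univ.toList.map (nodeTemplate X₀ Y₀ X₁)) D).toFinset (Conflict S)
      (fun f g => (f, g) ∈ templatePairs (nodeTemplatePairs X₀ Y₀ X₁ Kind.beats)
        (nodeTemplatePairs X₀ Y₀ X₁ Kind.lifts) D) where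
  prec_conflict _ _ := conflict_of_mem_pairs D
  prec_mem := D.valid.mem
  acyclic := D.valid.acyclic
  mk_eq_iff _ _ _ _ := h.nodeTemplate_fact_eq_iff
  mem_iff x := by
    simp only [templateFacts, List.mem_toFinset, List.mem_flatMap, List.mem_map,
      Finset.mem_toList, Finset.mem_univ, true_and, exists_exists_eq_and, eq_comm (a := x)]
    exact ⟨fun ⟨f, hf, κ, hx⟩ => ⟨κ, f, hf, hx⟩, fun ⟨κ, f, hf, hx⟩ => ⟨f, hf, κ, hx⟩⟩
  conf_iff _ _ _ _ := h.conflict_nodeTemplate_iff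
  prec_iff x y := by
    simp only [templatePairs, List.mem_append, List.mem_flatMap, List.mem_map,
      mem_nodeTemplatePairs, List.mem_toFinset, Prod.mk.injEq]
    constructor
    · rintro (⟨f, hf, _, ⟨κ, κ', hbeats, rfl⟩, rfl, rfl⟩ |
        ⟨p, hp, _, ⟨κ, κ', hlifts, rfl⟩, rfl, rfl⟩)
      · exact .inl ⟨κ, κ', f, hf, hbeats, rfl, rfl⟩
      · exact .inr ⟨κ, κ', p.1, p.2, hlifts, hp, rfl, rfl⟩
    · rintro (⟨κ, κ', f, hf, hbeats, rfl, rfl⟩ | ⟨κ, κ', f, g, hlifts, hfg, rfl, rfl⟩)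
      · exact .inl ⟨f, hf, _, ⟨κ, κ', hbeats, rfl⟩, rfl, rfl⟩
      · exact .inr ⟨(f, g), hfg, _, ⟨κ, κ', hlifts, rfl⟩, rfl, rfl⟩

end IsChain

theorem GCategoricityCoNPHard.of_isChain (h : GCategoricityCoNPHard schemaZero)
    (hchain : IsChain S R X₀ Y₀ X₁) : GCategoricityCoNPHard S :=
  h.of_template _ _ _ (fun D _ _ => (hchain.isGadget D).mem_of_prec)
    (fun D => (hchain.isGadget D).acyclic_prec) (fun D _ _ => (hchain.isGadget D).conf_of_prec)
    fun D => (hchain.isGadget D).existsUnique_optimal_iff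

end Chain

end Reduction

end CleanDB

theorem mainTheorem10 :
    CleanDB.GCategoricityCoNPHard CleanDB.schemaZero ↔
      ∀ S : CleanDB.Schema, ¬ S.SingleFDPerRelation → CleanDB.GCategoricityCoNPHard S := by
  refine ⟨fun h S hS => ?_, fun h => h _ CleanDB.not_singleFDPerRelation_schemaZero⟩
  simp only [CleanDB.Schema.SingleFDPerRelation, not_forall, not_exists, not_and] at hS
  obtain ⟨R, hR⟩ := hS
  rcases CleanDB.exists_violating_inter_or_isChain hR with
    ⟨P, Q, hP, hQ, hPQ⟩ | ⟨X₀, Y₀, X₁, hchain⟩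
  · exact h.of_violating_inter hP hQ hPQ
  · exact h.of_isChain hchain
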